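/- Let $0\le\epsilon<1$ and $k\ge 1$. A source generates at each time $t=0,1,2,\dots$ an independent symbol, uniform on $\mathbb F_q^k$, where $q$ is a prime power. At each such time there is also one use of the $q$-ary erasure channel without feedback: a sent symbol of $\mathbb F_q$ is received instantaneously, or erased with probability $\epsilon$, independently over the channel uses. For $n\ge k$, an $(n,k)$-scheme $\mathcal C$ consists of generator matrices $\mathbf G_l\in\mathbb F_q^{k\times n}$ ($l=0,1,\dots$) and a decoder. The source symbol $\mathbf u$ generated at time $ln$ is transmitted as $\mathbf u^T\mathbf G_l$ during the channel uses $ln,\dots,ln+n-1$, and all other source symbols are discarded. At every channel use the decoder outputs, as a function of the channel outputs so far, either nothing or the index and value of a source symbol, and it never outputs a wrong value. The age at time $t$ is $\Delta_{\epsilon,\mathcal C}(t)=t-u(t)$, where $u(t)$ is the generation time of the freshest symbol decoded by time $t$ (initially $-n$), and the average age $\Delta_{\epsilon,\mathcal C}$ is the almost sure constant value of $\lim_{\tau\to\infty}\frac1\tau\int_0^\tau\Delta_{\epsilon,\mathcal C}(t)\,dt$. The optimal average age $\Delta_\epsilon$ (for given $k$ and $q$) is the infimum of the average ages of all $(n,k)$-schemes,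 $n\ge k$, that have one. In the random $(n,k)$-code all columns of all matrices $\mathbf G_l$ are independent and uniform on $\mathbb F_q^k\setminus\{0\}$, and a message is decoded as soon as $k$ linearly independent coded symbols of its block have been received. Let $\Delta_{\epsilon,(n,k)}=\mathbb E(\Delta_{\epsilon,\mathcal C})$ be the expectation over the random code $\mathcal C$. Let $\tilde B$ and $\tilde{\tilde B}$ be sums of $k$ and of $k+1$ independent geometric random variables on $\{1,2,\dots\}$ with success probability $1-\epsilon$, and let $$\Delta^{lb}_{\epsilon,(n,k)}=\frac{2n(1-\epsilon)-(1-\epsilon)\,\mathbb P(\tilde B\le n)(n+2)+2k\,\mathbb P(\tilde{\tilde B}\le n+1)}{2(1-\epsilon)\,\mathbb P(\tilde B\le n)}.$$ Theorem. (1) For every $q$ and every $n\ge k$, almost every realization $\mathcal C$ of the random $(n,k)$-code has an average age, and $\Delta_{\epsilon,\mathcal C}=\Delta_{\epsilon,(n,k)}$. (2) For every $n\ge k$ and every $\delta>0$ there is $q_0>0$ such that for all prime powers $q\ge q_0$, almost every realization $\mathcal C$ of the random $(n,k)$-code satisfies $|\Delta_{\epsilon,\mathcal C}-\Delta^{lb}_{\epsilon,(n,k)}|<\delta$;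 in particular such a code exists, and $|\Delta_{\epsilon,(n,k)}-\Delta^{lb}_{\epsilon,(n,k)}|<\delta$. (3) Random codes are asymptotically age-optimal: for every $\delta>0$ there is $q_0>0$ such that for all prime powers $q\ge q_0$ the minimum $\min_{n\ge k}\Delta_{\epsilon,(n,k)}$ is attained and $\bigl|\Delta_\epsilon-\min_{n\ge k}\Delta_{\epsilon,(n,k)}\bigr|<\delta$. -/

import Mathlib

open MeasureTheory ProbabilityTheory Filter Topology

noncomputable section

namespace AgeErasure

/-- A coding scheme with blocklength `n` for source symbols in `F ^ k`, induced by linear codes.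
There is one channel use and one new source symbol at each of the times `0, 1, 2, …`. The symbol
generated at time `l * n` is the `l`-th transmitted message; it is encoded by an arbitrary linear
code with the `k × n` generator matrix `G_l = [col (l * n), …, col (l * n + n - 1)]`, whose coded
symbols are sent at the times `l * n, …, l * n + n - 1`. Source symbols generated in between
are discarded.

At channel use `i` the decoder sees all channel outputs so far (`none` is the erasure symbol) and
outputs either `none` or the index (generation time) and an estimate of a source symbol. -/
structure Scheme (F : Type*) (n k : ℕ) where
  /-- column of the generator matrix that is used at channel use `i` -/
  col : ℕ → Fin k → F
  /-- decoder at channel use `i` -/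
  dec : (i : ℕ) → (Fin (i + 1) → Option F) → Option (ℕ × (Fin k → F))

section Model

variable {F : Type*} [Field F] {n k : ℕ}

/-- Channel input at channel use `i`, when `u t` is the source symbol generated at time `t`. -/
def Scheme.channelInput (S : Scheme F n k) (u : ℕ → Fin k → F) (i : ℕ) : F :=
  u (i / n * n) ⬝ᵥ S.col i

/-- Channel output at channel use `i`, when `e` is the erasure pattern (`true` is an erasure). -/
def Scheme.channelOutput (S : Scheme F n k) (u : ℕ → Fin k → F) (e : ℕ → Bool) (i : ℕ) :
    Option F :=
  if e i = true then none else some (S.channelInput u i)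

/-- What the decoder of the scheme outputs at channel use `i`. -/
def Scheme.decoded (S : Scheme F n k) (u : ℕ → Fin k → F) (e : ℕ → Bool) (i : ℕ) :
    Option (ℕ × (Fin k → F)) :=
  S.dec i fun m => S.channelOutput u e m

/-- The decoder never outputs a wrong message: the error probability is zero. -/
def Scheme.ZeroError (S : Scheme F n k) : Prop :=
  ∀ (u : ℕ → Fin k → F) (e : ℕ → Bool) (i j : ℕ) (w : Fin k → F),
    S.decoded u e i = some (j, w) → w = u j

/-- Generation time of the freshest message decoded during the channel uses `0, …, N - 1`.
Observation begins right after a successful block, which started at time `-n`. -/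
def Scheme.freshest (S : Scheme F n k) (u : ℕ → Fin k → F) (e : ℕ → Bool) : ℕ → ℤ
  | 0 => -(n : ℤ)
  | N + 1 =>
    match S.decoded u e N with
    | none => S.freshest u e N
    | some (j, _) => max (S.freshest u e N) (j : ℤ)

/-- Instantaneous age at the real time `t ≥ 0`; the channel uses up to time `t` are those with
index at most `⌊t⌋₊`, since symbols are received instantaneously. -/
def Scheme.age (S : Scheme F n k) (u : ℕ → Fin k → F) (e : ℕ → Bool) (t : ℝ) : ℝ :=
  t - (S.freshest u e (⌊t⌋₊ + 1) : ℝ)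

end Model

/-- Law of the source: i.i.d. symbols, uniform on `F ^ k`. -/
def sourceLaw (F : Type*) [MeasurableSpace F] (k : ℕ) : Measure (ℕ → Fin k → F) :=
  Measure.infinitePi fun _ => uniformOn Set.univ

/-- Law of the erasures: i.i.d., each channel use is erased with probability `ε`. -/
def erasureLaw (ε : unitInterval) : Measure (ℕ → Bool) :=
  Measure.infinitePi fun _ => bernoulliMeasure true false ε

section Age

variable {F : Type*} [Field F] [MeasurableSpace F] {n k : ℕ}

/-- The average age of the scheme `S` over the erasure channel exists almost surely and is `D`. -/
def HasAverageAge (ε : unitInterval) (S : Scheme F n k) (D : ℝ) : Prop :=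
  ∀ᵐ p ∂((sourceLaw F k).prod (erasureLaw ε)),
    Tendsto (fun τ : ℝ => 1 / τ * ∫ t in (0 : ℝ)..τ, S.age p.1 p.2 t) atTop (𝓝 D)

open Classical in
/-- The average age of a scheme (`0` by convention if there is none). -/
def averageAge (ε : unitInterval) (S : Scheme F n k) : ℝ :=
  if h : ∃ D, HasAverageAge ε S D then h.choose else 0

end Age

/-- Law of the random code: all columns of all generator matrices are independent and uniform on
the nonzero vectors of `F ^ k`. -/
def randomCode (F : Type*) [Field F] [MeasurableSpace F] (k : ℕ) : Measure (ℕ → Fin k → F) :=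
  Measure.infinitePi fun _ => uniformOn {v : Fin k → F | v ≠ 0}

open Classical in
/-- The scheme with columns `g` and decoding on the fly: as soon as the columns of the unerased
symbols of the current block have rank `k`, the decoder solves the linear system for the message;
until then it outputs nothing. -/
def onTheFly {F : Type*} [Field F] {k : ℕ} (n : ℕ) (g : ℕ → Fin k → F) : Scheme F n k where
  col := g
  dec i y :=
    if h : Submodule.span F
          {v | ∃ m : Fin (i + 1), (m : ℕ) / n = i / n ∧ y m ≠ none ∧ v = g m} = ⊤ ∧
        ∃ w : Fin k → F, ∀ m : Fin (i + 1), (m : ℕ) / n = i / n →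
          ∀ z : F, y m = some z → w ⬝ᵥ g m = z
    then some (i / n * n, h.2.choose)
    else none

/-- Expected average age of the random `(n, k)`-scheme. -/
def randomCodeAge (ε : unitInterval) (F : Type*) [Field F] [MeasurableSpace F] (n k : ℕ) : ℝ :=
  ∫ g, averageAge ε (onTheFly n g) ∂(randomCode F k)

/-- The average ages achieved, without decoding errors, by the schemes that are induced by linear
`(n, k)`-codes of some blocklength `n ≥ k`; the optimal average age is the infimum of this set. -/
def achievedAges (ε : unitInterval) (F : Type*) [Field F] [MeasurableSpace F] (k : ℕ) : Set ℝ :=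
  {D | ∃ n, k ≤ n ∧ ∃ S : Scheme F n k, S.ZeroError ∧ HasAverageAge ε S D}

/-- Law of the sum of `m` independent random variables that are geometric on `{1, 2, …}` with
success probability `p` (Mathlib's geometric law counts the failures, hence the `+ 1`). -/
def geometricSum (m : ℕ) (p : unitInterval) : Measure ℕ :=
  (Measure.pi fun _ : Fin m => geometricMeasure p).map fun L => ∑ i, (L i + 1)

/-- The lower bound on the average age that corresponds to MDS codes. -/
def ageLowerBound (ε : unitInterval) (n k : ℕ) : ℝ :=
  let a : ℝ := (geometricSum k (unitInterval.symm ε)).real (Set.Iic n)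
  let b : ℝ := (geometricSum (k + 1) (unitInterval.symm ε)).real (Set.Iic (n + 1))
  (2 * n * (1 - ε) - (1 - ε) * a * (n + 2) + 2 * k * b) / (2 * (1 - ε) * a)

end AgeErasure

end

/-!
If decoding depends only on the unerased part of the current block, the blocks are independent
trials. When the message of a block is decoded within its first `m` channel uses with probability
`R m`, the strong law applied to the gaps between successful blocks gives the average age
`n / 2 + (∑_{1 ≤ m ≤ n} (1 - R m)) / R n`, which is decreasing in `R`. A decoder without errors has
seen at least `k` unerased symbols of the block, so its `R m` is at most the probability of `k`
successes in `m` trials, the distribution function of a sum of `k` geometric variables; for this `R`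
the formula is the lower bound of the theorem. A random code misses it only if one of its columns
falls into the proper subspace spanned by the previously received ones, which has probability at
most `m / q`. Since the average age with blocklength `n` is at least `n / 2`, minima over `n` exist
and one `q₀` suffices for them.
-/

noncomputable section

namespace AgeErasure

section StrongLaw

variable {Ω : Type*} [MeasurableSpace Ω] {P : Measure Ω}

theorem ae_tendsto_zero_of_summable_integral {f : ℕ → Ω → ℝ} (hf₀ : ∀ m ω, 0 ≤ f m ω)
    (hf : ∀ m, Integrable (f m) P) (hsum : Summable fun m => ∫ ω, f m ω ∂P) :
    ∀ᵐ ω ∂P, Tendsto (fun m => f m ω) atTop (𝓝 0) := by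
  have hfin : ∫⁻ ω, ∑' m, ENNReal.ofReal (f m ω) ∂P ≠ ⊤ := by
    simp_rw [lintegral_tsum fun m => (hf m).aemeasurable.ennreal_ofReal,
      ← fun m => ofReal_integral_eq_lintegral_ofReal (hf m) (Eventually.of_forall (hf₀ m)),
      ← ENNReal.ofReal_tsum_of_nonneg (fun m => integral_nonneg (hf₀ m)) hsum]
    exact ENNReal.ofReal_ne_top
  filter_upwards [ae_lt_top' (AEMeasurable.tsum fun m =>
    (hf m).aemeasurable.ennreal_ofReal) hfin] with ω hω
  have hlim := (ENNReal.tendsto_toReal ENNReal.zero_ne_top).comp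
    (ENNReal.tendsto_atTop_zero_of_tsum_ne_top hω.ne)
  exact hlim.congr fun m => ENNReal.toReal_ofReal (hf₀ m ω)

theorem ae_tendsto_zero_of_integral_sq_le {f : ℕ → Ω → ℝ} {K : ℝ} (hf : ∀ m, MemLp (f m) 2 P)
    (hK : ∀ m, ∫ ω, f m ω ^ 2 ∂P ≤ K / (m : ℝ) ^ 2) :
    ∀ᵐ ω ∂P, Tendsto (fun m => f m ω) atTop (𝓝 0) := by
  have hsum : Summable fun m => ∫ ω, f m ω ^ 2 ∂P :=
    .of_nonneg_of_le (fun m => integral_nonneg fun ω => sq_nonneg _) hK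
      ((Real.summable_nat_pow_inv.2 one_lt_two).mul_left K)
  filter_upwards [ae_tendsto_zero_of_summable_integral (fun m ω => sq_nonneg (f m ω))
    (fun m => (hf m).integrable_sq) hsum] with ω hω
  refine (tendsto_zero_iff_abs_tendsto_zero _).2 ?_
  simpa only [Real.sqrt_sq_eq_abs, Real.sqrt_zero, Function.comp_def] using hω.sqrt

theorem ae_tendsto_div_zero_of_integral_sq_le {X : ℕ → Ω → ℝ} {K : ℝ} (hX : ∀ N, MemLp (X N) 2 P)
    (hK : ∀ N, ∫ ω, X N ω ^ 2 ∂P ≤ K) :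
    ∀ᵐ ω ∂P, Tendsto (fun N : ℕ => X N ω / N) atTop (𝓝 0) := by
  refine ae_tendsto_zero_of_integral_sq_le (K := K)
    (fun N => by simpa only [div_eq_mul_inv] using (hX N).mul_const ((N : ℝ)⁻¹)) fun N => ?_
  simp only [div_pow, integral_div]
  gcongr
  exact hK N

theorem integral_sq_sum_of_orthogonal {ι : Type*} {X : ι → Ω → ℝ} (hX : ∀ i, MemLp (X i) 2 P)
    (horth : ∀ i j, i ≠ j → ∫ ω, X i ω * X j ω ∂P = 0) (s : Finset ι) :
    ∫ ω, (∑ i ∈ s, X i ω) ^ 2 ∂P = ∑ i ∈ s, ∫ ω, X i ω ^ 2 ∂P := by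
  have hint : ∀ i j, Integrable (fun ω => X i ω * X j ω) P := fun i j =>
    (hX i).integrable_mul (hX j)
  simp_rw [sq, Finset.sum_mul_sum]
  rw [integral_finsetSum _ fun i _ => integrable_finsetSum _ fun j _ => hint i j]
  refine Finset.sum_congr rfl fun i hi => ?_
  rw [integral_finsetSum _ fun j _ => hint i j]
  exact Finset.sum_eq_single_of_mem i hi fun j _ hj => horth i j hj.symm

theorem integral_sq_sum_abs_le {ι : Type*} {X : ι → Ω → ℝ} {K : ℝ} (hX : ∀ i, MemLp (X i) 2 P)
    (hK : ∀ i, ∫ ω, X i ω ^ 2 ∂P ≤ K) (s : Finset ι) :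
    ∫ ω, (∑ i ∈ s, |X i ω|) ^ 2 ∂P ≤ K * (s.card : ℝ) ^ 2 :=
  calc ∫ ω, (∑ i ∈ s, |X i ω|) ^ 2 ∂P ≤ ∫ ω, s.card * ∑ i ∈ s, X i ω ^ 2 ∂P := by
        refine integral_mono (memLp_finsetSum s fun i _ => (hX i).abs).integrable_sq
          ((integrable_finsetSum s fun i _ => (hX i).integrable_sq).const_mul _) fun ω => ?_
        simpa only [sq_abs] using sq_sum_le_card_mul_sum_sq (s := s) (f := fun i => |X i ω|)
    _ = s.card * ∑ i ∈ s, ∫ ω, X i ω ^ 2 ∂P := by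
        rw [integral_const_mul, integral_finsetSum _ fun i _ => (hX i).integrable_sq]
    _ ≤ s.card * ∑ _i ∈ s, K := by gcongr; exact hK _
    _ = K * (s.card : ℝ) ^ 2 := by rw [Finset.sum_const, nsmul_eq_mul]; ring

theorem abs_sum_range_div_le (x : ℕ → ℝ) (N : ℕ) :
    |(∑ i ∈ Finset.range N, x i) / N| ≤
      |(∑ i ∈ Finset.range (N.sqrt ^ 2), x i) / (N.sqrt : ℝ) ^ 2| +
        (∑ i ∈ Finset.Ico (N.sqrt ^ 2) ((N.sqrt + 1) ^ 2), |x i|) / (N.sqrt : ℝ) ^ 2 := by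
  obtain rfl | hN := N.eq_zero_or_pos
  · simp
  set m := N.sqrt
  have : 0 < m := Nat.sqrt_pos.2 hN
  have hmN : m ^ 2 ≤ N := Nat.sqrt_le' N
  have hsub : Finset.Ico (m ^ 2) N ⊆ Finset.Ico (m ^ 2) ((m + 1) ^ 2) :=
    Finset.Ico_subset_Ico_right (Nat.lt_succ_sqrt' N).le
  have hsum : |∑ i ∈ Finset.range N, x i| ≤ |∑ i ∈ Finset.range (m ^ 2), x i| +
      ∑ i ∈ Finset.Ico (m ^ 2) ((m + 1) ^ 2), |x i| := by
    rw [← Finset.sum_range_add_sum_Ico x hmN]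
    refine (abs_add_le _ _).trans (add_le_add_right ?_ _)
    exact (Finset.abs_sum_le_sum_abs _ _).trans
      (Finset.sum_le_sum_of_subset_of_nonneg hsub fun i _ _ => abs_nonneg _)
  rw [abs_div, abs_div, Nat.abs_cast, abs_of_nonneg (sq_nonneg (m : ℝ)), ← add_div]
  gcongr
  exact_mod_cast hmN

theorem ae_tendsto_sum_range_sq_div_zero {X : ℕ → Ω → ℝ} {K : ℝ}
    (hX : ∀ i, MemLp (X i) 2 P) (horth : ∀ i j, i ≠ j → ∫ ω, X i ω * X j ω ∂P = 0)
    (hK : ∀ i, ∫ ω, X i ω ^ 2 ∂P ≤ K) :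
    ∀ᵐ ω ∂P, Tendsto (fun m : ℕ => (∑ i ∈ Finset.range (m ^ 2), X i ω) / (m : ℝ) ^ 2)
      atTop (𝓝 0) := by
  refine ae_tendsto_zero_of_integral_sq_le (K := K) (fun m => ?_) fun m => ?_
  · simpa only [div_eq_mul_inv] using (memLp_finsetSum _ fun i _ => hX i).mul_const _
  simp_rw [div_pow, integral_div, integral_sq_sum_of_orthogonal hX horth]
  calc (∑ i ∈ Finset.range (m ^ 2), ∫ ω, X i ω ^ 2 ∂P) / ((m : ℝ) ^ 2) ^ 2
      ≤ (∑ _i ∈ Finset.range (m ^ 2), K) / ((m : ℝ) ^ 2) ^ 2 := by gcongr; exact hK _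
    _ = K / (m : ℝ) ^ 2 := by
      rw [Finset.sum_const, Finset.card_range, nsmul_eq_mul, Nat.cast_pow]
      obtain rfl | hm := m.eq_zero_or_pos
      · simp
      · field_simp

theorem ae_tendsto_sum_Ico_sq_abs_div_zero {X : ℕ → Ω → ℝ} {K : ℝ}
    (hX : ∀ i, MemLp (X i) 2 P) (hK : ∀ i, ∫ ω, X i ω ^ 2 ∂P ≤ K) :
    ∀ᵐ ω ∂P, Tendsto (fun m : ℕ =>
      (∑ i ∈ Finset.Ico (m ^ 2) ((m + 1) ^ 2), |X i ω|) / (m : ℝ) ^ 2) atTop (𝓝 0) := by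
  refine ae_tendsto_zero_of_integral_sq_le (K := 9 * K) (fun m => ?_) fun m => ?_
  · simpa only [div_eq_mul_inv, Pi.abs_apply] using
      (memLp_finsetSum _ fun i _ => (hX i).abs).mul_const _
  simp_rw [div_pow, integral_div]
  refine (div_le_div_of_nonneg_right (integral_sq_sum_abs_le hX hK _) (by positivity)).trans ?_
  have hcard : (m + 1) ^ 2 - m ^ 2 = 2 * m + 1 := by grind
  rw [Nat.card_Ico, hcard]
  obtain rfl | hm := m.eq_zero_or_pos
  · simp
  have hm' : (1 : ℝ) ≤ m := by exact_mod_cast hm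
  have hK₀ : 0 ≤ K := (integral_nonneg fun ω => sq_nonneg (X 0 ω)).trans (hK 0)
  calc K * ((2 * m + 1 : ℕ) : ℝ) ^ 2 / ((m : ℝ) ^ 2) ^ 2
      ≤ K * (3 * m) ^ 2 / ((m : ℝ) ^ 2) ^ 2 := by
        gcongr; push_cast; linarith
    _ = 9 * K / (m : ℝ) ^ 2 := by field_simp; ring

-- The squares `m ^ 2` are sparse enough for the second moments at `N = m ^ 2` to be summable, and
-- dense enough to control the partial sums in between.
theorem ae_tendsto_sum_div_zero_of_orthogonal {X : ℕ → Ω → ℝ} {K : ℝ}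
    (hX : ∀ i, MemLp (X i) 2 P) (horth : ∀ i j, i ≠ j → ∫ ω, X i ω * X j ω ∂P = 0)
    (hK : ∀ i, ∫ ω, X i ω ^ 2 ∂P ≤ K) :
    ∀ᵐ ω ∂P, Tendsto (fun N : ℕ => (∑ i ∈ Finset.range N, X i ω) / N) atTop (𝓝 0) := by
  have hsqrt : Tendsto Nat.sqrt atTop atTop :=
    tendsto_atTop_atTop.2 fun b => ⟨b ^ 2, fun N hN => Nat.le_sqrt'.2 hN⟩
  filter_upwards [ae_tendsto_sum_range_sq_div_zero hX horth hK,
    ae_tendsto_sum_Ico_sq_abs_div_zero hX hK] with ω hω₁ hω₂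
  refine squeeze_zero_norm (fun N => abs_sum_range_div_le (fun i => X i ω) N) ?_
  simpa only [abs_zero, add_zero, Function.comp_def] using
    (hω₁.abs.comp hsqrt).add (hω₂.comp hsqrt)

end StrongLaw

open Classical in
/-- Time since the last good round before round `l`; round `-1` counts as good. -/
def runLength (good : ℕ → Prop) : ℕ → ℕ
  | 0 => 1
  | l + 1 => if good l then 1 else runLength good l + 1

section Renewal

theorem runLength_le (good : ℕ → Prop) (l : ℕ) : runLength good l ≤ l + 1 := by
  induction l with
  | zero => rfl
  | succ l ih => rw [runLength]; split_ifs <;> lia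

theorem runLength_congr {good good' : ℕ → Prop} {l : ℕ} (h : ∀ j < l, (good j ↔ good' j)) :
    runLength good l = runLength good' l := by
  induction l with
  | zero => rfl
  | succ l ih =>
    rw [runLength, runLength, ih fun j hj => h j (Nat.lt_succ_of_lt hj),
      propext (h l l.lt_succ_self)]

open Classical in
theorem sum_runLength_mul_ite (good : ℕ → Prop) (N : ℕ) :
    ∑ l ∈ Finset.range N, (runLength good l : ℝ) * (if good l then 1 else 0) =
      N + 1 - runLength good N := by
  induction N with
  | zero => simp [runLength]
  | succ N ih =>
    rw [Finset.sum_range_succ, ih, runLength]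
    split_ifs <;> push_cast <;> ring

open Classical in
theorem sum_runLength_mul_sub_ite (good : ℕ → Prop) (c : ℕ → ℝ) (a b : ℝ) (N : ℕ) :
    ∑ l ∈ Finset.range N, runLength good l * (a * c l - b * (if good l then 1 else 0)) =
      a * ∑ l ∈ Finset.range N, runLength good l * c l - b * (N + 1 - runLength good N) := by
  rw [← sum_runLength_mul_ite, Finset.mul_sum, Finset.mul_sum, ← Finset.sum_sub_distrib]
  exact Finset.sum_congr rfl fun l _ => by ring

theorem dependsOn_runLength {E : Type*} (A : Set E) (l : ℕ) :
    DependsOn (fun x : ℕ → E => runLength (fun j => x j ∈ A) l) (Set.Iio l) :=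
  fun _ _ hxy => runLength_congr fun j hj => by rw [hxy j hj]

variable {E : Type*} [MeasurableSpace E] {ρ : Measure E} [IsProbabilityMeasure ρ]

theorem indepFun_eval_of_dependsOn {ι β : Type*} [MeasurableSpace β] {f : (ι → E) → β}
    {S : Finset ι} {j : ι} (hf : Measurable f) (hdep : DependsOn f S) (hj : j ∉ S) :
    IndepFun f (fun x => x j) (Measure.infinitePi fun _ : ι => ρ) := by
  classical
  obtain ⟨e⟩ := ρ.nonempty_of_neZero
  let extend : (S → E) → ι → E := fun y i => if hi : i ∈ S then y ⟨i, hi⟩ else e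
  have hextend : Measurable extend := measurable_pi_lambda _ fun i => by
    by_cases hi : i ∈ S
    · simpa only [extend, hi, dite_true] using measurable_pi_apply _
    · simpa only [extend, hi, dite_false] using measurable_const
  have hfactor : f = f ∘ extend ∘ fun x i => x i := by
    ext1 x
    exact hdep fun i hi => Eq.symm (dif_pos (Finset.mem_coe.1 hi) : extend (fun i => x i) i = x i)
  have hindep := (iIndepFun_infinitePi (P := fun _ : ι => ρ) (X := fun _ y => y)
    fun _ => measurable_id).indepFun_finset S {j} (Finset.disjoint_singleton_right.2 hj)
    fun i => measurable_pi_apply i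
  rw [hfactor]
  exact hindep.comp (hf.comp hextend)
    (measurable_pi_apply (⟨j, Finset.mem_singleton_self j⟩ : ({j} : Finset ι)))

local notation "𝐏" => Measure.infinitePi fun _ : ℕ => ρ

theorem indepFun_eval_of_dependsOn_Iio {f : (ℕ → E) → ℝ} {l : ℕ} (hf : Measurable f)
    (hdep : DependsOn f (Set.Iio l)) : IndepFun f (fun x => x l) 𝐏 :=
  indepFun_eval_of_dependsOn (S := Finset.range l) hf (by rwa [Finset.coe_range])
    Finset.notMem_range_self

theorem integral_eval_infinitePi {c : E → ℝ} (hc : AEStronglyMeasurable c ρ) (l : ℕ) :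
    ∫ x, c (x l) ∂𝐏 = ∫ y, c y ∂ρ :=
  (measurePreserving_eval_infinitePi (fun _ : ℕ => ρ) l).hasLaw.integral_comp hc

theorem integral_mul_eval_of_dependsOn {f : (ℕ → E) → ℝ} {c : E → ℝ} {l : ℕ} (hf : Measurable f)
    (hdep : DependsOn f (Set.Iio l)) (hc : Measurable c) :
    ∫ x, f x * c (x l) ∂𝐏 = (∫ x, f x ∂𝐏) * ∫ y, c y ∂ρ := by
  rw [← integral_eval_infinitePi hc.aestronglyMeasurable l]
  exact ((indepFun_eval_of_dependsOn_Iio hf hdep).comp measurable_id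
    hc).integral_fun_mul_eq_mul_integral hf.aestronglyMeasurable
    (hc.comp (measurable_pi_apply l)).aestronglyMeasurable

theorem memLp_mul_eval_of_dependsOn {f : (ℕ → E) → ℝ} {c : E → ℝ} {l : ℕ} (hf : Measurable f)
    (hdep : DependsOn f (Set.Iio l)) (hf₂ : MemLp f 2 𝐏) (hc : Measurable c) (hc₂ : MemLp c 2 ρ) :
    MemLp (fun x => f x * c (x l)) 2 𝐏 := by
  have hc_eval : MemLp (fun x : ℕ → E => c (x l)) 2 𝐏 :=
    hc₂.comp_measurePreserving (measurePreserving_eval_infinitePi (fun _ : ℕ => ρ) l)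
  refine (memLp_two_iff_integrable_sq (hf₂.1.mul hc_eval.1)).2 ?_
  simp_rw [Pi.mul_apply, mul_pow]
  exact ((indepFun_eval_of_dependsOn_Iio hf hdep).comp (measurable_id.pow_const 2)
    (hc.pow_const 2)).integrable_mul hf₂.integrable_sq hc_eval.integrable_sq

-- The weights `a l` are predictable, so the summands are martingale differences.
theorem ae_tendsto_sum_mul_eval_div_zero {a : ℕ → (ℕ → E) → ℝ} {h : E → ℝ} {K : ℝ}
    (ha : ∀ l, Measurable (a l)) (hdep : ∀ l, DependsOn (a l) (Set.Iio l))
    (ha₂ : ∀ l, MemLp (a l) 2 𝐏) (hK : ∀ l, ∫ x, a l x ^ 2 ∂𝐏 ≤ K)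
    (hh : Measurable h) (hh₂ : MemLp h 2 ρ) (hmean : ∫ y, h y ∂ρ = 0) :
    ∀ᵐ x ∂𝐏, Tendsto (fun N : ℕ => (∑ l ∈ Finset.range N, a l x * h (x l)) / N) atTop (𝓝 0) := by
  have horth : ∀ i j, i < j → ∫ x, a i x * h (x i) * (a j x * h (x j)) ∂𝐏 = 0 := fun i j hij => by
    have hdep_j : DependsOn (fun x => a i x * h (x i) * a j x) (Set.Iio j) := fun x y hxy => by
      simp only [hdep j hxy, hdep i fun m hm => hxy m (lt_trans hm hij), hxy i hij]
    have hmeas_j : Measurable fun x => a i x * h (x i) * a j x :=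
      ((ha i).mul (hh.comp (measurable_pi_apply i))).mul (ha j)
    simp_rw [← mul_assoc]
    rw [integral_mul_eval_of_dependsOn hmeas_j hdep_j hh, hmean, mul_zero]
  refine ae_tendsto_sum_div_zero_of_orthogonal (K := K * ∫ y, h y ^ 2 ∂ρ)
    (fun l => memLp_mul_eval_of_dependsOn (ha l) (hdep l) (ha₂ l) hh hh₂) (fun i j hij => ?_)
    fun l => ?_
  · obtain hlt | hlt := hij.lt_or_gt
    · exact horth i j hlt
    · simpa only [mul_comm] using horth j i hlt
  · simp_rw [mul_pow]
    rw [integral_mul_eval_of_dependsOn (f := fun x => a l x ^ 2) (c := fun y => h y ^ 2)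
      ((ha l).pow_const 2) (fun x y hxy => by simp only [hdep l hxy]) (hh.pow_const 2)]
    gcongr
    exact hK l

variable {A : Set E}

theorem measurable_runLength (hA : MeasurableSet A) (l : ℕ) :
    Measurable fun x : ℕ → E => runLength (fun j => x j ∈ A) l := by
  induction l with
  | zero => exact measurable_const
  | succ l ih =>
    exact Measurable.ite (measurable_pi_apply l hA) measurable_const (ih.add_const 1)

theorem memLp_comp_runLength (hA : MeasurableSet A) (l : ℕ) (φ : ℕ → ℝ) :
    MemLp (fun x => φ (runLength (fun j => x j ∈ A) l)) 2 𝐏 :=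
  MemLp.of_bound ((measurable_of_countable φ).comp (measurable_runLength hA l)).aestronglyMeasurable
    (∑ i ∈ Finset.range (l + 2), ‖φ i‖) <| Eventually.of_forall fun _ =>
      Finset.single_le_sum (f := fun i => ‖φ i‖) (fun _ _ => norm_nonneg _)
        (Finset.mem_range.2 (Nat.lt_succ_of_le (runLength_le _ l)))

theorem integral_sq_runLength_succ (hA : MeasurableSet A) (l : ℕ) :
    ∫ x, (runLength (fun j => x j ∈ A) (l + 1) : ℝ) ^ 2 ∂𝐏 =
      ρ.real A + (1 - ρ.real A) * ∫ x, ((runLength (fun j => x j ∈ A) l : ℝ) + 1) ^ 2 ∂𝐏 := by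
  let a : (ℕ → E) → ℝ := fun x => ((runLength (fun j => x j ∈ A) l : ℝ) + 1) ^ 2
  have ha : Measurable a := (measurable_of_countable fun r : ℕ => ((r : ℝ) + 1) ^ 2).comp
    (measurable_runLength hA l)
  have ha_dep : DependsOn a (Set.Iio l) := fun x y hxy => by
    simp only [a, dependsOn_runLength A l hxy]
  have ha_int : Integrable a 𝐏 :=
    (memLp_comp_runLength hA l fun r => ((r : ℝ) + 1) ^ 2).integrable one_le_two
  have hind : ∀ B : Set E, MeasurableSet B → Measurable (B.indicator (1 : E → ℝ)) :=
    fun B hB => measurable_one.indicator hB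
  have hsplit : ∀ x : ℕ → E, (runLength (fun j => x j ∈ A) (l + 1) : ℝ) ^ 2 =
      A.indicator 1 (x l) + a x * Aᶜ.indicator 1 (x l) := fun x => by
    by_cases hx : x l ∈ A <;> simp [runLength, hx, a]
  have hgood : ∫ x, A.indicator (1 : E → ℝ) (x l) ∂𝐏 = ρ.real A :=
    (integral_eval_infinitePi (hind A hA).aestronglyMeasurable l).trans (integral_indicator_one hA)
  have hbad : ∫ x, a x * Aᶜ.indicator (1 : E → ℝ) (x l) ∂𝐏 =
      (∫ x, a x ∂𝐏) * (1 - ρ.real A) := by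
    rw [integral_mul_eval_of_dependsOn ha ha_dep (hind _ hA.compl),
      integral_indicator_one hA.compl, probReal_compl_eq_one_sub hA]
  simp_rw [hsplit]
  rw [integral_add _ _, hgood, hbad, mul_comm]
  · exact .of_bound ((hind A hA).comp (measurable_pi_apply l)).aestronglyMeasurable 1 <|
      Eventually.of_forall fun x => by by_cases hx : x l ∈ A <;> simp [hx]
  · exact ha_int.mul_bdd (c := 1)
      ((hind _ hA.compl).comp (measurable_pi_apply l)).aestronglyMeasurable <|
      Eventually.of_forall fun x => by by_cases hx : x l ∈ A <;> simp [hx]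

theorem integral_sq_runLength_le (hA : MeasurableSet A) (hρA : ρ.real A ≠ 0) (l : ℕ) :
    ∫ x, (runLength (fun j => x j ∈ A) l : ℝ) ^ 2 ∂𝐏 ≤ 1 / ρ.real A ^ 3 := by
  set p := ρ.real A
  have hp : 0 < p := hρA.symm.lt_of_le measureReal_nonneg
  have hp₁ : p ≤ 1 := measureReal_le_one
  induction l with
  | zero =>
    simpa [runLength] using (one_le_inv₀ (pow_pos hp 3)).2 (pow_le_one₀ hp.le hp₁)
  | succ l ih =>
    have hamgm : ∀ r : ℝ, (r + 1) ^ 2 ≤ (1 + p) * r ^ 2 + (1 + 1 / p) := fun r => by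
      have hsq : 0 ≤ (p * r - 1) ^ 2 / p := by positivity
      have hid : (p * r - 1) ^ 2 / p = p * r ^ 2 - 2 * r + 1 / p := by field_simp; ring
      linarith
    have hint : Integrable (fun x => (runLength (fun j => x j ∈ A) l : ℝ) ^ 2) 𝐏 :=
      (memLp_comp_runLength hA l Nat.cast).integrable_sq
    have hmoment : ∫ x, ((runLength (fun j => x j ∈ A) l : ℝ) + 1) ^ 2 ∂𝐏 ≤
        (1 + p) * (1 / p ^ 3) + (1 + 1 / p) :=
      calc _ ≤ ∫ x, ((1 + p) * (runLength (fun j => x j ∈ A) l : ℝ) ^ 2 + (1 + 1 / p)) ∂𝐏 :=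
            integral_mono (memLp_comp_runLength hA l fun r => (r : ℝ) + 1).integrable_sq
              ((hint.const_mul _).add (integrable_const _)) fun x => hamgm _
        _ = (1 + p) * ∫ x, (runLength (fun j => x j ∈ A) l : ℝ) ^ 2 ∂𝐏 + (1 + 1 / p) := by
            rw [integral_add (hint.const_mul _) (integrable_const _), integral_const_mul,
              integral_const, probReal_univ, one_smul]
        _ ≤ _ := by gcongr
    rw [integral_sq_runLength_succ hA]
    calc p + (1 - p) * ∫ x, ((runLength (fun j => x j ∈ A) l : ℝ) + 1) ^ 2 ∂𝐏
        ≤ p + (1 - p) * ((1 + p) * (1 / p ^ 3) + (1 + 1 / p)) := by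
          gcongr
      _ = 1 / p ^ 3 := by field_simp; ring

theorem ae_tendsto_sum_runLength_mul_div (hA : MeasurableSet A) (hρA : ρ.real A ≠ 0)
    {c : E → ℝ} (hc : Measurable c) (hL2 : MemLp c 2 ρ) :
    ∀ᵐ x ∂𝐏, Tendsto (fun N : ℕ =>
      (∑ l ∈ Finset.range N, runLength (fun j => x j ∈ A) l * c (x l)) / N)
      atTop (𝓝 ((∫ y, c y ∂ρ) / ρ.real A)) := by
  set p := ρ.real A
  set μ := ∫ y, c y ∂ρ
  let h : E → ℝ := fun y => p * c y - μ * A.indicator 1 y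
  have hind : MemLp (A.indicator (1 : E → ℝ)) 2 ρ :=
    memLp_indicator_const 2 hA 1 (Or.inr (measure_ne_top ρ A))
  have hmean : ∫ y, h y ∂ρ = 0 := by
    rw [integral_sub ((hL2.integrable one_le_two).const_mul p)
      ((hind.integrable one_le_two).const_mul μ), integral_const_mul, integral_const_mul,
      integral_indicator_one hA]
    ring
  filter_upwards [ae_tendsto_sum_mul_eval_div_zero
      (fun l => (measurable_of_countable Nat.cast).comp (measurable_runLength hA l))
      (fun l _ _ hxy => congrArg Nat.cast (dependsOn_runLength A l hxy))
      (fun l => memLp_comp_runLength hA l Nat.cast) (integral_sq_runLength_le hA hρA)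
      ((hc.const_mul p).sub ((measurable_one.indicator hA).const_mul μ))
      ((hL2.const_mul p).sub (hind.const_mul μ)) hmean,
    ae_tendsto_div_zero_of_integral_sq_le (fun l => memLp_comp_runLength hA l Nat.cast)
      (integral_sq_runLength_le hA hρA)] with x hsum hrun
  have hlim : Tendsto (fun N : ℕ =>
      ((∑ l ∈ Finset.range N, runLength (fun j => x j ∈ A) l * h (x l)) / N +
        μ * (1 + 1 / N - runLength (fun j => x j ∈ A) N / N)) / p) atTop (𝓝 (μ / p)) := by
    simpa using ((hsum.add ((((tendsto_one_div_atTop_nhds_zero_nat (𝕜 := ℝ)).const_add 1).sub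
      hrun).const_mul μ)).div_const p)
  refine hlim.congr' ((eventually_gt_atTop 0).mono fun N hN => ?_)
  have hdecomp : ∑ l ∈ Finset.range N, runLength (fun j => x j ∈ A) l * h (x l) =
      p * ∑ l ∈ Finset.range N, runLength (fun j => x j ∈ A) l * c (x l) -
        μ * (N + 1 - runLength (fun j => x j ∈ A) N) :=
    sum_runLength_mul_sub_ite (fun j => x j ∈ A) (fun l => c (x l)) p μ N
  rw [hdecomp]
  field_simp
  ring

end Renewal

section TimeAverage

theorem tendsto_div_atTop_of_tendsto_nat_mul {F : ℝ → ℝ} (hF : MonotoneOn F (Set.Ici 0)) {a D : ℝ}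
    (ha : 0 < a) (h : Tendsto (fun N : ℕ => F (N * a) / (N * a)) atTop (𝓝 D)) :
    Tendsto (fun t => F t / t) atTop (𝓝 D) := by
  let N : ℝ → ℕ := fun t => ⌊a⁻¹ * t⌋₊
  have hN : Tendsto N atTop atTop :=
    tendsto_nat_floor_atTop.comp (tendsto_id.const_mul_atTop (inv_pos.2 ha))
  have hlow : Tendsto (fun t => N t * a / t) atTop (𝓝 1) := by
    have := (tendsto_nat_floor_mul_div_atTop (inv_pos.2 ha).le).mul_const a
    rw [inv_mul_cancel₀ ha.ne'] at this
    exact this.congr fun t => div_mul_eq_mul_div _ _ _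
  have hupp : Tendsto (fun t => ((N t + 1 : ℕ) : ℝ) * a / t) atTop (𝓝 1) := by
    have := hlow.add (tendsto_const_nhds.div_atTop tendsto_id : Tendsto (a / ·) atTop (𝓝 0))
    rw [add_zero] at this
    exact this.congr fun t => by push_cast; ring
  refine tendsto_of_tendsto_of_tendsto_of_le_of_le'
    (by simpa only [mul_one] using (h.comp hN).mul hlow)
    (by simpa only [mul_one] using (h.comp ((tendsto_add_atTop_nat 1).comp hN)).mul hupp) ?_ ?_
  · filter_upwards [eventually_gt_atTop 0, hN.eventually_gt_atTop 0] with t ht hNt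
    have hle : N t * a ≤ t := by
      rw [mul_comm, ← le_inv_mul_iff₀ ha]
      exact Nat.floor_le (by positivity)
    simp only [Function.comp_apply]
    rw [div_mul_div_cancel₀ (by positivity)]
    gcongr
    exact hF (Set.mem_Ici.2 (by positivity)) ht.le hle
  · filter_upwards [eventually_gt_atTop 0] with t ht
    have hle : t ≤ ((N t + 1 : ℕ) : ℝ) * a := by
      rw [mul_comm, ← inv_mul_le_iff₀ ha]
      exact_mod_cast (Nat.lt_floor_add_one (a⁻¹ * t)).le
    simp only [Function.comp_apply]
    rw [div_mul_div_cancel₀ (by positivity)]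
    gcongr
    exact hF ht.le (Set.mem_Ici.2 (by positivity)) hle

variable {f : ℕ → ℝ}

theorem intervalIntegrable_id_sub_floor (hf : Monotone f) (a b : ℝ) :
    IntervalIntegrable (fun t : ℝ => t - f (⌊t⌋₊ + 1)) volume a b :=
  intervalIntegral.intervalIntegrable_id.sub <| Monotone.intervalIntegrable fun _ _ hxy =>
    hf (Nat.add_le_add_right (Nat.floor_le_floor hxy) 1)

theorem integral_id_sub_floor_unit (f : ℕ → ℝ) (i : ℕ) :
    ∫ t in (i : ℝ)..(i + 1 : ℕ), (t - f (⌊t⌋₊ + 1)) = i + 1 / 2 - f (i + 1) := by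
  have hfloor : ∫ t in (i : ℝ)..(i + 1 : ℕ), (t - f (⌊t⌋₊ + 1)) =
      ∫ t in (i : ℝ)..(i + 1 : ℕ), (t - f (i + 1)) := by
    refine intervalIntegral.integral_congr_ae ?_
    filter_upwards [Measure.ae_ne volume ((i + 1 : ℕ) : ℝ)] with t ht hti
    rw [Set.uIoc_of_le (by simp)] at hti
    rw [(Nat.floor_eq_iff ((Nat.cast_nonneg i).trans hti.1.le)).2
      ⟨hti.1.le, by exact_mod_cast lt_of_le_of_ne hti.2 ht⟩]
  rw [hfloor, intervalIntegral.integral_sub intervalIntegral.intervalIntegrable_id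
    intervalIntegrable_const, integral_id, intervalIntegral.integral_const]
  simp only [Nat.cast_add_one, add_sub_cancel_left, one_smul]
  ring

theorem integral_id_sub_floor (hf : Monotone f) (N : ℕ) :
    ∫ t in (0 : ℝ)..N, (t - f (⌊t⌋₊ + 1)) =
      ∑ i ∈ Finset.range N, ((i : ℝ) + 1 / 2 - f (i + 1)) := by
  rw [← Nat.cast_zero, ← intervalIntegral.sum_integral_adjacent_intervals
    (a := fun i : ℕ => (i : ℝ)) fun _ _ => intervalIntegrable_id_sub_floor hf _ _]
  exact Finset.sum_congr rfl fun i _ => integral_id_sub_floor_unit f i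

theorem tendsto_average_id_sub_floor (hf : Monotone f) (hle : ∀ i, f (i + 1) ≤ i) {n : ℕ}
    (hn : 0 < n) {D : ℝ} (h : Tendsto (fun N : ℕ =>
      (∑ i ∈ Finset.range (N * n), ((i : ℝ) + 1 / 2 - f (i + 1))) / (N * n)) atTop (𝓝 D)) :
    Tendsto (fun τ : ℝ => 1 / τ * ∫ t in (0 : ℝ)..τ, (t - f (⌊t⌋₊ + 1))) atTop (𝓝 D) := by
  have hmono : MonotoneOn (fun τ => ∫ t in (0 : ℝ)..τ, (t - f (⌊t⌋₊ + 1))) (Set.Ici 0) := by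
    intro a ha b _ hab
    have hint := intervalIntegrable_id_sub_floor hf
    simp only
    rw [← intervalIntegral.integral_add_adjacent_intervals (hint 0 a) (hint a b)]
    refine le_add_of_nonneg_right (intervalIntegral.integral_nonneg hab fun t ht => ?_)
    exact sub_nonneg.2 ((hle _).trans (Nat.floor_le (le_trans ha ht.1)))
  simp_rw [one_div_mul_eq_div]
  refine tendsto_div_atTop_of_tendsto_nat_mul hmono (Nat.cast_pos.2 hn) (h.congr fun N => ?_)
  rw [← integral_id_sub_floor hf, Nat.cast_mul]

end TimeAverage

section Freshest

open Classical in
/-- Generation time of the freshest message decoded during the channel uses `0, …, N - 1` if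
`good i` tells whether the message of the current block has been decoded at channel use `i`. -/
def freshestOf (n : ℕ) (good : ℕ → Prop) : ℕ → ℤ
  | 0 => -(n : ℤ)
  | N + 1 => if good N then max (freshestOf n good N) ((N / n * n : ℕ) : ℤ) else freshestOf n good N

variable {n : ℕ} {good : ℕ → Prop}

theorem monotone_freshestOf (n : ℕ) (good : ℕ → Prop) : Monotone (freshestOf n good) :=
  monotone_nat_of_le_succ fun N => by
    rw [freshestOf]
    split_ifs
    exacts [le_max_left _ _, le_rfl]

theorem freshestOf_succ_le (n : ℕ) (good : ℕ → Prop) (N : ℕ) : freshestOf n good (N + 1) ≤ N := by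
  have hblock : ((N / n * n : ℕ) : ℤ) ≤ N := by exact_mod_cast Nat.div_mul_le_self N n
  have hprev : freshestOf n good N ≤ N := by
    cases N with
    | zero => simp [freshestOf]
    | succ N => exact (freshestOf_succ_le n good N).trans (by simp)
  rw [freshestOf]
  split_ifs
  exacts [max_le hprev hblock, hprev]

theorem freshestOf_le (n : ℕ) (good : ℕ → Prop) (N : ℕ) : freshestOf n good N ≤ N :=
  (monotone_freshestOf n good N.le_succ).trans (freshestOf_succ_le n good N)

theorem le_freshestOf {i N : ℕ} (hi : good i) (hN : i < N) :
    ((i / n * n : ℕ) : ℤ) ≤ freshestOf n good N := by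
  refine le_trans ?_ (monotone_freshestOf n good hN)
  rw [freshestOf, if_pos hi]
  exact le_max_right _ _

theorem mul_add_div_of_lt {m : ℕ} (l : ℕ) (hm : m < n) : (l * n + m) / n = l := by
  rw [add_comm, Nat.add_mul_div_right _ _ (Nat.zero_lt_of_lt hm), Nat.div_eq_of_lt hm, zero_add]

open Classical in
theorem freshestOf_mul_add (hgood : ∀ l m, m + 1 < n → good (l * n + m) → good (l * n + m + 1))
    (l : ℕ) {m : ℕ} (hm : m < n) :
    freshestOf n good (l * n + m + 1) =
      if good (l * n + m) then ((l * n : ℕ) : ℤ) else freshestOf n good (l * n) := by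
  rw [freshestOf, mul_add_div_of_lt l hm]
  induction m with
  | zero => rw [add_zero, max_eq_right (freshestOf_le _ _ _)]
  | succ m ih =>
    rw [← add_assoc, freshestOf, mul_add_div_of_lt l (by lia), ih (by lia)]
    have hnext := hgood l m hm
    have hle := freshestOf_le n good (l * n)
    split_ifs <;> grind

theorem freshestOf_mul (hn : 0 < n)
    (hgood : ∀ l m, m + 1 < n → good (l * n + m) → good (l * n + m + 1)) (l : ℕ) :
    freshestOf n good (l * n) = (l - runLength (fun l => good (l * n + (n - 1))) l) * n := by
  induction l with
  | zero => simp [freshestOf, runLength]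
  | succ l ih =>
    have hlast : (l + 1) * n = l * n + (n - 1) + 1 := by rw [Nat.succ_mul]; lia
    rw [hlast, freshestOf_mul_add hgood l (by lia), runLength, ih]
    split_ifs <;> push_cast <;> ring

open Classical in
theorem sum_age_block (hn : 0 < n)
    (hgood : ∀ l m, m + 1 < n → good (l * n + m) → good (l * n + m + 1)) (l : ℕ) :
    ∑ m ∈ Finset.range n, (((l * n + m : ℕ) : ℝ) + 1 / 2 - freshestOf n good (l * n + m + 1)) =
      n ^ 2 / 2 + n * (runLength (fun l => good (l * n + (n - 1))) l *
        ∑ m : Fin n, if good (l * n + m) then 0 else 1) := by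
  set r := runLength (fun l => good (l * n + (n - 1))) l
  have hterm : ∀ m ∈ Finset.range n,
      ((l * n + m : ℕ) : ℝ) + 1 / 2 - freshestOf n good (l * n + m + 1) =
        (m + 1 / 2) + n * r * if good (l * n + m) then 0 else 1 := fun m hm => by
    rw [freshestOf_mul_add hgood l (Finset.mem_range.1 hm), freshestOf_mul hn hgood]
    split_ifs <;> push_cast <;> ring
  have hgauss : ∀ N : ℕ, ∑ m ∈ Finset.range N, ((m : ℝ) + 1 / 2) = N ^ 2 / 2 := fun N => by
    induction N with
    | zero => simp
    | succ N ih => rw [Finset.sum_range_succ, ih]; push_cast; ring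
  rw [Finset.sum_congr rfl hterm, Finset.sum_add_distrib, hgauss, ← Finset.mul_sum,
    Finset.sum_range, mul_assoc]

theorem sum_range_mul_eq_sum_sum {M : Type*} [AddCommMonoid M] (g : ℕ → M) (N n : ℕ) :
    ∑ i ∈ Finset.range (N * n), g i =
      ∑ l ∈ Finset.range N, ∑ m ∈ Finset.range n, g (l * n + m) := by
  induction N with
  | zero => simp
  | succ N ih => rw [Nat.succ_mul, Finset.sum_range_add, Finset.sum_range_succ, ih]

open Classical in
theorem tendsto_average_freshestOf (hn : 0 < n)
    (hgood : ∀ l m, m + 1 < n → good (l * n + m) → good (l * n + m + 1)) {L : ℝ}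
    (h : Tendsto (fun N : ℕ => (∑ l ∈ Finset.range N,
      (runLength (fun l => good (l * n + (n - 1))) l : ℝ) *
        ∑ m : Fin n, if good (l * n + m) then 0 else 1) / N) atTop (𝓝 L)) :
    Tendsto (fun τ : ℝ => 1 / τ * ∫ t in (0 : ℝ)..τ, (t - (freshestOf n good (⌊t⌋₊ + 1) : ℝ)))
      atTop (𝓝 (n / 2 + L)) := by
  refine tendsto_average_id_sub_floor (f := fun i => (freshestOf n good i : ℝ))
    (Int.cast_mono.comp (monotone_freshestOf n good))
    (fun i => by exact_mod_cast freshestOf_succ_le n good i) hn ?_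
  refine (h.const_add (n / 2 : ℝ)).congr' ((eventually_gt_atTop 0).mono fun N hN => ?_)
  simp_rw [sum_range_mul_eq_sum_sum, sum_age_block hn hgood]
  rw [Finset.sum_add_distrib, ← Finset.mul_sum, Finset.sum_const, Finset.card_range, nsmul_eq_mul]
  field_simp

end Freshest

/-- Average age of a scheme that decodes a message within the first `m` of the `n` channel uses of
its block with probability `R m`. -/
def ageOfCdf (n : ℕ) (R : ℕ → ℝ) : ℝ :=
  n / 2 + (∑ m ∈ Finset.range n, (1 - R (m + 1))) / R n

section Blocks

variable {Y : Type*} {n : ℕ} {G : ∀ m, Set (Fin m → Y)}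

/-- Whether the part of the current block of length `n` of `ω` that is known at time `i` passes
the test `G`. -/
def blockTest (n : ℕ) (G : ∀ m, Set (Fin m → Y)) (ω : ℕ → Y) (i : ℕ) : Prop :=
  (fun j : Fin (i % n + 1) => ω (i / n * n + j)) ∈ G (i % n + 1)

theorem blockTest_mul_add {ω : ℕ → Y} (l : ℕ) {m : ℕ} (hm : m < n) :
    blockTest n G ω (l * n + m) ↔ (fun j : Fin (m + 1) => ω (l * n + j)) ∈ G (m + 1) := by
  have hmod : (l * n + m) % n = m := by rw [Nat.mul_add_mod', Nat.mod_eq_of_lt hm]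
  have hdiv := mul_add_div_of_lt l hm
  rw [blockTest]
  generalize (l * n + m) % n = m' at hmod
  generalize (l * n + m) / n = l' at hdiv
  rw [hmod, hdiv]

theorem blockTest_mul_add_pred {ω : ℕ → Y} (hn : 0 < n) (l : ℕ) :
    blockTest n G ω (l * n + (n - 1)) ↔ (fun j : Fin n => ω (l * n + j)) ∈ G n := by
  obtain ⟨n, rfl⟩ := Nat.exists_eq_succ_of_ne_zero hn.ne'
  exact blockTest_mul_add l n.lt_succ_self

theorem blockTest_mul_add_succ (hG : ∀ m (x : Fin (m + 1) → Y), Fin.init x ∈ G m → x ∈ G (m + 1))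
    {ω : ℕ → Y} (l m : ℕ) (hm : m + 1 < n) (h : blockTest n G ω (l * n + m)) :
    blockTest n G ω (l * n + m + 1) :=
  (blockTest_mul_add l hm).2 (hG _ _ ((blockTest_mul_add l (Nat.lt_of_succ_lt hm)).1 h))

open Classical in
/-- Number of nonempty prefixes of the block `y` that fail the test `G`. -/
def failureCount (G : ∀ m, Set (Fin m → Y)) (y : Fin n → Y) : ℝ :=
  ∑ m : Fin n, if Fin.take (m + 1) m.2 y ∈ G (m + 1) then 0 else 1

theorem failureCount_nonneg (y : Fin n → Y) : 0 ≤ failureCount G y :=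
  Finset.sum_nonneg fun _ _ => by split_ifs <;> norm_num

theorem failureCount_le (y : Fin n → Y) : failureCount G y ≤ n := by
  refine (Finset.sum_le_card_nsmul _ _ 1 fun _ _ => ?_).trans_eq (by simp)
  split_ifs <;> norm_num

variable [MeasurableSpace Y]

theorem measurable_failureCount (hG : ∀ m, MeasurableSet (G m)) :
    Measurable (failureCount (n := n) G) :=
  Finset.measurable_sum _ fun _ _ => Measurable.ite
    ((measurable_pi_lambda _ fun _ => measurable_pi_apply _) (hG _)) measurable_const
    measurable_const

variable {ν : Measure Y} [IsProbabilityMeasure ν]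

theorem memLp_failureCount (hG : ∀ m, MeasurableSet (G m)) (p : ENNReal) :
    MemLp (failureCount (n := n) G) p (Measure.pi fun _ => ν) :=
  .of_bound (measurable_failureCount hG).aestronglyMeasurable n <| ae_of_all _ fun y => by
    rw [Real.norm_of_nonneg (failureCount_nonneg y)]
    exact failureCount_le y

theorem measurePreserving_infinitePi_comp {ι κ : Type*} {f : κ → ι} (hf : Function.Injective f) :
    MeasurePreserving (fun (ω : ι → Y) i => ω (f i)) (Measure.infinitePi fun _ => ν)
      (Measure.infinitePi fun _ => ν) :=
  ⟨by fun_prop, Measure.map_infinitePi_infinitePi_of_inj hf⟩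

theorem measurePreserving_take {m : ℕ} (hm : m ≤ n) :
    MeasurePreserving (fun y : Fin n → Y => Fin.take m hm y) (Measure.pi fun _ => ν)
      (Measure.pi fun _ => ν) := by
  rw [← Measure.infinitePi_eq_pi, ← Measure.infinitePi_eq_pi]
  exact measurePreserving_infinitePi_comp (Fin.castLE_injective hm)

theorem measurePreserving_blocks (hn : 0 < n) :
    MeasurePreserving (fun (ω : ℕ → Y) (l : ℕ) (j : Fin n) => ω (l * n + j))
      (Measure.infinitePi fun _ => ν) (Measure.infinitePi fun _ => Measure.pi fun _ => ν) := by
  have : NeZero n := ⟨hn.ne'⟩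
  have hcurry : MeasurePreserving (MeasurableEquiv.curry ℕ (Fin n) Y)
      (Measure.infinitePi fun _ => ν) (Measure.infinitePi fun _ => Measure.pi fun _ => ν) := by
    refine ⟨MeasurableEquiv.measurable _, ?_⟩
    simp_rw [← Measure.infinitePi_eq_pi]
    exact Measure.infinitePi_map_curry fun _ _ => ν
  exact hcurry.comp (measurePreserving_infinitePi_comp (Nat.divModEquiv n).symm.injective)

open Classical in
theorem integral_failureCount (hG : ∀ m, MeasurableSet (G m)) :
    ∫ y, failureCount G y ∂(Measure.pi fun _ : Fin n => ν) =
      ∑ m ∈ Finset.range n, (1 - (Measure.pi fun _ : Fin (m + 1) => ν).real (G (m + 1))) := by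
  set A : Fin n → Set (Fin n → Y) := fun m => Fin.take (m + 1) m.2 ⁻¹' G (m + 1)
  have hA : ∀ m, MeasurableSet (A m) := fun m =>
    (measurePreserving_take (ν := ν) m.2).measurable (hG _)
  have hterm : ∀ (m : Fin n) (y : Fin n → Y),
      (if Fin.take (m + 1) m.2 y ∈ G (m + 1) then (0 : ℝ) else 1) = (A m)ᶜ.indicator 1 y := by
    intro m y
    simp only [A, Set.indicator_apply, Set.mem_compl_iff, Set.mem_preimage, ite_not, Pi.one_apply]
  have hint : ∀ m, Integrable ((A m)ᶜ.indicator (1 : (Fin n → Y) → ℝ)) (Measure.pi fun _ => ν) :=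
    fun m => (integrable_const (1 : ℝ)).indicator (hA m).compl
  simp_rw [failureCount, hterm]
  rw [integral_finsetSum _ fun m _ => hint m, Finset.sum_range]
  refine Finset.sum_congr rfl fun m _ => ?_
  rw [integral_indicator_one (hA m).compl, probReal_compl_eq_one_sub (hA m),
    (measurePreserving_take m.2).measureReal_preimage (hG _).nullMeasurableSet]

theorem ae_tendsto_average_blockTest (hn : 0 < n) (hG : ∀ m, MeasurableSet (G m))
    (hinit : ∀ m (x : Fin (m + 1) → Y), Fin.init x ∈ G m → x ∈ G (m + 1))
    (hpos : (Measure.pi fun _ : Fin n => ν).real (G n) ≠ 0) :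
    ∀ᵐ ω ∂(Measure.infinitePi fun _ : ℕ => ν), Tendsto
      (fun τ : ℝ => 1 / τ *
        ∫ t in (0 : ℝ)..τ, (t - (freshestOf n (blockTest n G ω) (⌊t⌋₊ + 1) : ℝ)))
      atTop (𝓝 (ageOfCdf n fun m => (Measure.pi fun _ : Fin m => ν).real (G m))) := by
  have hrenewal := ae_tendsto_sum_runLength_mul_div (hG n) hpos (measurable_failureCount hG)
    (memLp_failureCount (ν := ν) hG 2)
  filter_upwards [(measurePreserving_blocks hn).quasiMeasurePreserving.ae hrenewal] with ω hω
  rw [integral_failureCount hG] at hω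
  refine tendsto_average_freshestOf hn (blockTest_mul_add_succ hinit) (hω.congr fun N => ?_)
  simp_rw [blockTest_mul_add_pred hn]
  congr! 3 with l
  exact Finset.sum_congr rfl fun m _ => by congr 1; exact propext (blockTest_mul_add l m.2).symm

end Blocks

section AgeOfCdf

variable {n : ℕ} {R R' : ℕ → ℝ}

theorem ageOfCdf_le_ageOfCdf (hR : ∀ m, R m ≤ R' m) (hR₁ : ∀ m, R m ≤ 1) (hn : 0 < R n) :
    ageOfCdf n R' ≤ ageOfCdf n R := by
  refine add_le_add_right (div_le_div₀ ?_ ?_ hn (hR n)) _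
  · exact Finset.sum_nonneg fun _ _ => sub_nonneg.2 (hR₁ _)
  · exact Finset.sum_le_sum fun _ _ => sub_le_sub_left (hR _) 1

theorem half_le_ageOfCdf (hR₁ : ∀ m, R m ≤ 1) (hn : 0 ≤ R n) : (n : ℝ) / 2 ≤ ageOfCdf n R :=
  le_add_of_nonneg_right
    (div_nonneg (Finset.sum_nonneg fun _ _ => sub_nonneg.2 (hR₁ _)) hn)

theorem tendsto_ageOfCdf {ι : Type*} {l : Filter ι} {f : ι → ℕ → ℝ}
    (hf : ∀ m, Tendsto (fun i => f i m) l (𝓝 (R m))) (hn : R n ≠ 0) :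
    Tendsto (fun i => ageOfCdf n (f i)) l (𝓝 (ageOfCdf n R)) :=
  tendsto_const_nhds.add
    ((tendsto_finsetSum _ fun _ _ => tendsto_const_nhds.sub (hf _)).div (hf n) hn)

end AgeOfCdf

section WaitingTime

/-- Probability that there are at least `k` successes among `m` independent trials with success
probability `p`, that is, that the waiting time for `k` successes is at most `m`; defined by
conditioning on a single trial. -/
def waitCdf (p : ℝ) : ℕ → ℕ → ℝ
  | 0, _ => 1
  | _ + 1, 0 => 0
  | k + 1, m + 1 => p * waitCdf p k m + (1 - p) * waitCdf p (k + 1) m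

variable {p : ℝ}

@[simp]
theorem waitCdf_zero_left (m : ℕ) : waitCdf p 0 m = 1 := by rw [waitCdf]

@[simp]
theorem waitCdf_succ_zero (k : ℕ) : waitCdf p (k + 1) 0 = 0 := by rw [waitCdf]

theorem waitCdf_succ_succ (k m : ℕ) :
    waitCdf p (k + 1) (m + 1) = p * waitCdf p k m + (1 - p) * waitCdf p (k + 1) m := by
  rw [waitCdf]

theorem waitCdf_mem_Icc (hp : p ∈ Set.Icc 0 1) (k m : ℕ) : waitCdf p k m ∈ Set.Icc 0 1 := by
  induction m generalizing k with
  | zero => cases k <;> simp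
  | succ m ih =>
    cases k with
    | zero => simp
    | succ k =>
      rw [waitCdf_succ_succ]
      exact convex_Icc 0 1 (ih k) (ih (k + 1)) hp.1 (sub_nonneg.2 hp.2) (add_sub_cancel _ _)

theorem waitCdf_pos (hp : p ∈ Set.Ioc 0 1) {k m : ℕ} (hkm : k ≤ m) : 0 < waitCdf p k m := by
  induction m generalizing k with
  | zero => simp [Nat.le_zero.1 hkm]
  | succ m ih =>
    cases k with
    | zero => simp
    | succ k =>
      rw [waitCdf_succ_succ]
      exact add_pos_of_pos_of_nonneg (mul_pos hp.1 (ih (Nat.le_of_succ_le_succ hkm)))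
        (mul_nonneg (sub_nonneg.2 hp.2) (waitCdf_mem_Icc (Set.Ioc_subset_Icc_self hp) _ _).1)

-- If `N_m` counts the successes in `m` trials: `(j+1) P(N_{m+1} = j+1) = (m+1) p P(N_m = j)`.
theorem succ_mul_waitCdf_sub (j m : ℕ) :
    ((j : ℝ) + 1) * (waitCdf p (j + 1) (m + 1) - waitCdf p (j + 2) (m + 1)) =
      (m + 1) * p * (waitCdf p j m - waitCdf p (j + 1) m) := by
  induction m generalizing j with
  | zero => cases j <;> simp [waitCdf_succ_succ]
  | succ m ih =>
    rw [waitCdf_succ_succ j (m + 1), waitCdf_succ_succ (j + 1) (m + 1)]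
    cases j with
    | zero =>
      have ih₀ := ih 0
      rw [waitCdf_succ_succ 0 m] at ih₀ ⊢
      simp only [waitCdf_zero_left] at ih₀ ⊢
      push_cast at ih₀ ⊢
      linear_combination (1 - p) * ih₀
    | succ i =>
      have ih₀ := ih i
      have ih₁ := ih (i + 1)
      rw [waitCdf_succ_succ i m, waitCdf_succ_succ (i + 1) m] at *
      push_cast at *
      linear_combination (1 - p) * ih₁ + p * ih₀

theorem sum_waitCdf (hp : p ≠ 0) {k : ℕ} (hk : 1 ≤ k) (n : ℕ) :
    ∑ m ∈ Finset.range n, waitCdf p k (m + 1) =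
      (n + 1) * waitCdf p k n - k * waitCdf p (k + 1) (n + 1) / p := by
  obtain ⟨j, rfl⟩ := Nat.exists_eq_add_of_le' hk
  induction n with
  | zero => simp [waitCdf_succ_succ]
  | succ n ih =>
    have hsub := succ_mul_waitCdf_sub (p := p) j n
    have hrec := waitCdf_succ_succ (p := p) j n
    rw [Finset.sum_range_succ, ih, waitCdf_succ_succ (j + 1) (n + 1)]
    field_simp
    push_cast
    linear_combination p * hsub - (n + 1) * p * hrec

end WaitingTime

section GeometricSum

variable {p : unitInterval}

theorem measurable_sum_add_one (k : ℕ) :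
    Measurable fun L : Fin k → ℕ => ∑ i, (L i + 1) := by fun_prop

instance isProbabilityMeasure_geometricSum (k : ℕ) (p : unitInterval) :
    IsProbabilityMeasure (geometricSum k p) :=
  Measure.isProbabilityMeasure_map (measurable_sum_add_one k).aemeasurable

theorem geometricSum_succ (k : ℕ) (p : unitInterval) :
    geometricSum (k + 1) p = (geometricMeasure p).map (· + 1) ∗ geometricSum k p := by
  have hsplit := (measurePreserving_piFinSuccAbove
    (fun _ : Fin (k + 1) => geometricMeasure p) 0).symm.map_eq
  rw [Measure.conv, geometricSum, geometricSum,
    Measure.map_prod_map _ _ measurable_from_top (measurable_sum_add_one k), ← hsplit,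
    Measure.map_map (measurable_sum_add_one _) (MeasurableEquiv.measurable _),
    Measure.map_map (by fun_prop) (by fun_prop)]
  congr 1
  ext L
  simp [Fin.sum_univ_succ, Fin.insertNthEquiv]

-- Lack of memory: condition on the success of the first trial.
theorem geometricMeasure_eq_add_map_succ (hp : p ≠ 0) :
    geometricMeasure p = ENNReal.ofReal p • Measure.dirac 0 +
      ENNReal.ofReal (1 - p) • (geometricMeasure p).map (· + 1) := by
  refine Measure.ext_of_singleton fun a => ?_
  rw [Measure.add_apply, Measure.smul_apply, Measure.smul_apply,
    Measure.map_apply measurable_from_top .of_discrete, geometricMeasure_singleton hp]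
  cases a with
  | zero => simp [Set.preimage]
  | succ a =>
    have hpre : (· + 1) ⁻¹' {a + 1} = ({a} : Set ℕ) := by ext; simp
    rw [hpre, geometricMeasure_singleton hp, smul_eq_mul, smul_eq_mul,
      ← ENNReal.ofReal_mul (sub_nonneg.2 p.2.2)]
    simp [pow_succ', mul_assoc]

theorem geometricSum_succ_eq_add_map (hp : p ≠ 0) (k : ℕ) :
    geometricSum (k + 1) p = ENNReal.ofReal p • (geometricSum k p).map (1 + ·) +
      ENNReal.ofReal (1 - p) • (geometricSum (k + 1) p).map (1 + ·) := by
  have : IsProbabilityMeasure ((geometricMeasure p).map (· + 1)) :=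
    Measure.isProbabilityMeasure_map (by fun_prop)
  have hG : (geometricMeasure p).map (· + 1) = ENNReal.ofReal p • Measure.dirac 1 +
      ENNReal.ofReal (1 - p) • (Measure.dirac 1 ∗ (geometricMeasure p).map (· + 1)) := by
    conv_lhs => rw [geometricMeasure_eq_add_map_succ hp]
    rw [Measure.map_add _ _ (by fun_prop), Measure.map_smul, Measure.map_smul,
      Measure.map_dirac' (by fun_prop), Measure.dirac_conv]
    simp only [add_comm]
  rw [geometricSum_succ, ← Measure.dirac_conv, ← Measure.dirac_conv]
  conv_lhs => rw [hG]
  rw [Measure.add_conv, Measure.conv_smul_left, Measure.conv_smul_left, Measure.conv_assoc]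

theorem geometricSum_succ_real (hp : p ≠ 0) (k : ℕ) (s : Set ℕ) :
    (geometricSum (k + 1) p).real s = p * (geometricSum k p).real ((1 + ·) ⁻¹' s) +
      (1 - p) * (geometricSum (k + 1) p).real ((1 + ·) ⁻¹' s) := by
  conv_lhs => rw [geometricSum_succ_eq_add_map hp]
  simp only [measureReal_def, Measure.add_apply, Measure.smul_apply, smul_eq_mul,
    Measure.map_apply measurable_from_top (MeasurableSet.of_discrete (s := s))]
  rw [ENNReal.toReal_add (by finiteness) (by finiteness), ENNReal.toReal_mul, ENNReal.toReal_mul,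
    ENNReal.toReal_ofReal p.2.1, ENNReal.toReal_ofReal (sub_nonneg.2 p.2.2)]

theorem geometricSum_real_Iic (hp : p ≠ 0) (k m : ℕ) :
    (geometricSum k p).real (Set.Iic m) = waitCdf p k m := by
  induction m generalizing k with
  | zero =>
    cases k with
    | zero => simp [geometricSum, measureReal_def]
    | succ k =>
      rw [geometricSum_succ_real hp]
      simp [Set.preimage]
  | succ m ih =>
    cases k with
    | zero => simp [geometricSum, measureReal_def]
    | succ k =>
      have hpre : (1 + ·) ⁻¹' Set.Iic (m + 1) = Set.Iic m := by ext; simp; lia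
      rw [geometricSum_succ_real hp, hpre, ih, ih, waitCdf_succ_succ]

theorem ageLowerBound_eq_ageOfCdf {ε : unitInterval} (hε : (ε : ℝ) < 1) {n k : ℕ} (hk : 1 ≤ k)
    (hkn : k ≤ n) : ageLowerBound ε n k = ageOfCdf n (waitCdf (1 - ε) k) := by
  have hp : (0 : ℝ) < 1 - ε := sub_pos.2 hε
  have hp₀ : unitInterval.symm ε ≠ 0 := fun h => hp.ne' (congrArg Subtype.val h)
  have hpos : 0 < waitCdf (1 - (ε : ℝ)) k n := waitCdf_pos ⟨hp, sub_le_self _ ε.2.1⟩ hkn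
  rw [ageLowerBound, geometricSum_real_Iic hp₀, geometricSum_real_Iic hp₀, ageOfCdf,
    Finset.sum_sub_distrib, unitInterval.coe_symm_eq, sum_waitCdf hp.ne' hk, Finset.sum_const,
    Finset.card_range, nsmul_one]
  field_simp
  ring

end GeometricSum

section Successes

open Classical in
/-- The number of coordinates of `y` that lie in the set `s` of successes. -/
def successCount {ι Y : Type*} [Fintype ι] (s : Set Y) (y : ι → Y) : ℕ :=
  (Finset.univ.filter fun i => y i ∈ s).card

variable {Y : Type*} {m : ℕ}

open Classical in
theorem successCount_cons (s : Set Y) (a : Y) (y : Fin m → Y) :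
    successCount s (Fin.cons a y : Fin (m + 1) → Y) =
      (if a ∈ s then 1 else 0) + successCount s y := by
  simp only [successCount, Finset.card_filter, Fin.sum_univ_succ, Fin.cons_zero, Fin.cons_succ]

theorem successCount_init_le (s : Set Y) (y : Fin (m + 1) → Y) :
    successCount s (Fin.init y) ≤ successCount s y := by
  classical
  simp only [successCount, Finset.card_filter, Fin.sum_univ_castSucc]
  exact Nat.le_add_right _ _

variable [MeasurableSpace Y]

theorem measurable_successCount {s : Set Y} (hs : MeasurableSet s) :
    Measurable (successCount s : (Fin m → Y) → ℕ) := by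
  classical
  unfold successCount
  simp only [Finset.card_filter]
  exact Finset.measurable_fun_sum _ fun i _ =>
    Measurable.ite (measurable_pi_apply i hs) measurable_const measurable_const

theorem measurePreserving_cons (ν : Measure Y) [SigmaFinite ν] (m : ℕ) :
    MeasurePreserving (fun z : Y × (Fin m → Y) => (Fin.cons z.1 z.2 : Fin (m + 1) → Y))
      (ν.prod (Measure.pi fun _ => ν)) (Measure.pi fun _ => ν) := by
  convert (measurePreserving_piFinSuccAbove (fun _ : Fin (m + 1) => ν) 0).symm
  ext z
  simp [Fin.insertNthEquiv]

theorem measureReal_le_successCount (ν : Measure Y) [IsProbabilityMeasure ν] {s : Set Y}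
    (hs : MeasurableSet s) (k m : ℕ) :
    (Measure.pi fun _ : Fin m => ν).real {y | k ≤ successCount s y} = waitCdf (ν.real s) k m := by
  induction m generalizing k with
  | zero => cases k <;> simp [successCount]
  | succ m ih =>
    cases k with
    | zero => simp
    | succ k =>
      have hmeas : ∀ j m, MeasurableSet {y : Fin m → Y | j ≤ successCount s y} := fun j m =>
        measurableSet_le measurable_const (measurable_successCount hs)
      have hpre : (fun z : Y × (Fin m → Y) => (Fin.cons z.1 z.2 : Fin (m + 1) → Y)) ⁻¹'
          {y | k + 1 ≤ successCount s y} =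
          s ×ˢ {y | k ≤ successCount s y} ∪ sᶜ ×ˢ {y | k + 1 ≤ successCount s y} := by
        ext z
        by_cases hz : z.1 ∈ s <;> simp [successCount_cons, hz]
        lia
      rw [← (measurePreserving_cons ν m).measureReal_preimage (hmeas _ _).nullMeasurableSet, hpre,
        measureReal_union (Set.disjoint_left.2 fun z hz hz' => hz'.1 hz.1)
          (hs.compl.prod (hmeas _ _)),
        measureReal_prod_prod, measureReal_prod_prod, ih, ih, probReal_compl_eq_one_sub hs,
        waitCdf_succ_succ]

end Successes

section ReceivedSpan

variable (F : Type*) {W ι : Type*} [Field F] [AddCommGroup W] [Module F W] {m : ℕ}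

/-- The span of the columns whose symbols are received; each column comes with the erasure
indicator of its symbol. -/
def receivedSpan (y : ι → W × Bool) : Submodule F W :=
  Submodule.span F ((fun i => (y i).1) '' {i | (y i).2 = false})

/-- The number of unerased symbols. -/
def receivedCount [Fintype ι] (y : ι → W × Bool) : ℕ :=
  successCount {z | z.2 = false} y

theorem finrank_receivedSpan_le [Fintype ι] (y : ι → W × Bool) :
    Module.finrank F (receivedSpan F y) ≤ receivedCount y := by
  classical
  have hspan : receivedSpan F y = Submodule.span F
      (((Finset.univ.filter fun i => (y i).2 = false).image fun i => (y i).1 : Finset W) :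
        Set W) := by
    simp [receivedSpan]
  rw [hspan]
  refine (finrank_span_finset_le_card _).trans (Finset.card_image_le.trans_eq ?_)
  simp [receivedCount, successCount]

theorem receivedSpan_init_le (y : Fin (m + 1) → W × Bool) :
    receivedSpan F (Fin.init y) ≤ receivedSpan F y :=
  Submodule.span_mono fun _ ⟨i, hi, hv⟩ => ⟨i.castSucc, hi, hv⟩

theorem receivedSpan_cons_le (a : W × Bool) (y : Fin m → W × Bool) :
    receivedSpan F y ≤ receivedSpan F (Fin.cons a y : Fin (m + 1) → W × Bool) :=
  Submodule.span_mono fun _ ⟨i, hi, hv⟩ => ⟨i.succ, by simpa using hi, by simpa using hv⟩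

theorem mem_receivedSpan {y : ι → W × Bool} {i : ι} (hi : (y i).2 = false) :
    (y i).1 ∈ receivedSpan F y :=
  Submodule.subset_span ⟨i, hi, rfl⟩

/-- The received columns are linearly dependent although they do not span the whole space. -/
def Deficient [Fintype ι] (y : ι → W × Bool) : Prop :=
  receivedSpan F y ≠ ⊤ ∧ Module.finrank F (receivedSpan F y) < receivedCount y

theorem Deficient.of_cons [FiniteDimensional F W] {a : W × Bool} {y : Fin m → W × Bool}
    (h : Deficient F (Fin.cons a y : Fin (m + 1) → W × Bool)) :
    Deficient F y ∨ receivedSpan F y ≠ ⊤ ∧ a.1 ∈ receivedSpan F y := by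
  obtain ⟨htop, hlt⟩ := h
  have hle := receivedSpan_cons_le F a y
  have hy : receivedSpan F y ≠ ⊤ := fun hy => htop (top_le_iff.1 (hy ▸ hle))
  by_contra! hcon
  have hcount : receivedCount y ≤ Module.finrank F (receivedSpan F y) :=
    not_lt.1 fun hlt => hcon.1 ⟨hy, hlt⟩
  rw [receivedCount, successCount_cons] at hlt
  change _ < _ + receivedCount y at hlt
  by_cases ha : a.2 = false
  · have hmem := mem_receivedSpan F (y := (Fin.cons a y : Fin (m + 1) → W × Bool)) (i := 0) ha
    have hssub : receivedSpan F y < receivedSpan F (Fin.cons a y : Fin (m + 1) → W × Bool) :=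
      lt_of_le_of_ne hle fun heq => hcon.2 hy (heq ▸ hmem)
    have := Submodule.finrank_lt_finrank_of_lt hssub
    simp only [Set.mem_ofPred_eq, ha, if_true] at hlt
    lia
  · have := Submodule.finrank_mono hle
    simp only [Set.mem_ofPred_eq, ha] at hlt
    lia

theorem deficient_of_finrank_le [FiniteDimensional F W] [Fintype ι] {y : ι → W × Bool}
    (h : Module.finrank F W ≤ receivedCount y) (htop : receivedSpan F y ≠ ⊤) : Deficient F y :=
  ⟨htop, (Submodule.finrank_lt htop).trans_le h⟩

variable [Finite W] [MeasurableSpace W] [DiscreteMeasurableSpace W]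

theorem measure_deficient_le {ν : Measure (W × Bool)} [IsProbabilityMeasure ν] {c : ENNReal}
    (hc : ∀ V : Submodule F W, V ≠ ⊤ → ν {z | z.1 ∈ V} ≤ c) (m : ℕ) :
    (Measure.pi fun _ : Fin m => ν) {y | Deficient F y} ≤ m * c := by
  induction m with
  | zero => simp [Deficient, receivedCount, successCount]
  | succ m ih =>
    let μ := Measure.pi fun _ : Fin m => ν
    let S : Set ((W × Bool) × (Fin m → W × Bool)) :=
      {z | receivedSpan F z.2 ≠ ⊤ ∧ z.1.1 ∈ receivedSpan F z.2}
    have hS : (ν.prod μ) S ≤ c := by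
      rw [Measure.prod_apply_symm .of_discrete]
      refine (lintegral_mono (g := fun _ => c) fun y => ?_).trans (by simp)
      by_cases hy : receivedSpan F y = ⊤
      · simp [S, hy]
      · exact (measure_mono fun _ hz => hz.2).trans (hc _ hy)
    rw [← (measurePreserving_cons ν m).measure_preimage MeasurableSet.of_discrete.nullMeasurableSet]
    calc (ν.prod μ) _ ≤ (ν.prod μ) (Set.univ ×ˢ {y | Deficient F y} ∪ S) :=
          measure_mono fun z hz => hz.of_cons.imp (fun h => ⟨trivial, h⟩) id
      _ ≤ (ν.prod μ) (Set.univ ×ˢ {y | Deficient F y}) + (ν.prod μ) S := measure_union_le _ _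
      _ ≤ m * c + c := by gcongr; simpa [Measure.prod_prod] using ih
      _ = (m + 1 : ℕ) * c := by push_cast; ring

end ReceivedSpan

section RandomColumns

-- For `w ∉ V` the vectors `v + c • w`, `v ∈ V \ {0}`, `c ∈ F`, are distinct and nonzero.
theorem card_mul_ncard_diff_zero_le {F W : Type*} [Field F] [AddCommGroup W] [Module F W]
    [Finite W] {V : Submodule F W} (hV : V ≠ ⊤) :
    Nat.card F * ((V : Set W) \ {0}).ncard ≤ {v : W | v ≠ 0}.ncard := by
  obtain ⟨w, hw⟩ : ∃ w, w ∉ V := by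
    by_contra! h
    exact hV (eq_top_iff.2 fun v _ => h v)
  have hc : ∀ c : F, c • w ∈ V → c = 0 := fun c hc => by
    by_contra h0
    exact hw ((V.smul_mem_iff h0).1 hc)
  rw [← Set.ncard_univ, ← Set.ncard_prod]
  refine Set.ncard_le_ncard_of_injOn (fun p : F × W => p.2 + p.1 • w) ?_ ?_
  · rintro ⟨c, v⟩ ⟨-, hv, hv₀⟩ hzero
    have : c = 0 := hc c ((V.add_mem_iff_right hv).1 (hzero ▸ V.zero_mem))
    simp_all
  · rintro ⟨c, v⟩ ⟨-, hv, -⟩ ⟨c', v'⟩ ⟨-, hv', -⟩ heq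
    have hsub : (c - c') • w = v' - v := by
      simp only at heq
      rw [sub_smul, sub_eq_sub_iff_add_eq_add, add_comm, heq]
    have : c = c' := sub_eq_zero.1 (hc _ (hsub ▸ V.sub_mem hv' hv))
    simp_all

variable (F : Type*) [Field F] [MeasurableSpace F]

/-- Law of one column of the random code. -/
def columnLaw (k : ℕ) : Measure (Fin k → F) := uniformOn {v | v ≠ 0}

/-- Joint law of a column of the random code and of the erasure indicator of its symbol. -/
def symbolLaw (k : ℕ) (ε : unitInterval) : Measure ((Fin k → F) × Bool) :=
  (columnLaw F k).prod (bernoulliMeasure true false ε)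

/-- Probability that the symbols received among the first `m` of a block determine the message. -/
def decodableProb (k : ℕ) (ε : unitInterval) (m : ℕ) : ℝ :=
  (Measure.pi fun _ : Fin m => symbolLaw F k ε).real {y | receivedSpan F y = ⊤}

variable [Finite F] [DiscreteMeasurableSpace F] {k : ℕ} {ε : unitInterval}

instance isProbabilityMeasure_columnLaw [NeZero k] : IsProbabilityMeasure (columnLaw F k) :=
  isProbabilityMeasure_uniformOn (Set.toFinite _) ⟨1, one_ne_zero⟩

instance isProbabilityMeasure_symbolLaw [NeZero k] : IsProbabilityMeasure (symbolLaw F k ε) := by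
  unfold symbolLaw; infer_instance

variable {F}

theorem columnLaw_le {V : Submodule F (Fin k → F)} (hV : V ≠ ⊤) :
    columnLaw F k V ≤ (Nat.card F : ENNReal)⁻¹ := by
  have hinter : {v : Fin k → F | v ≠ 0} ∩ V = (V : Set (Fin k → F)) \ {0} := by
    ext v
    simp [and_comm]
  rw [columnLaw, uniformOn, cond_apply .of_discrete, hinter, mul_comm, ← div_eq_mul_inv,
    Measure.count_apply .of_discrete, Measure.count_apply .of_discrete,
    ← (Set.toFinite _).cast_ncard_eq, ← (Set.toFinite _).cast_ncard_eq]
  refine ENNReal.div_le_of_le_mul ?_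
  rw [mul_comm, ← div_eq_mul_inv, ENNReal.le_div_iff_mul_le
    (.inl (Nat.cast_ne_zero.2 Nat.card_pos.ne')) (by simp), mul_comm]
  exact_mod_cast card_mul_ncard_diff_zero_le hV

theorem symbolLaw_real_received [NeZero k] :
    (symbolLaw F k ε).real {y | y.2 = false} = 1 - ε := by
  have : {y : (Fin k → F) × Bool | y.2 = false} = Set.univ ×ˢ {false} := by
    ext y
    simp
  rw [symbolLaw, this, measureReal_prod_prod]
  simp

theorem decodableProb_le_waitCdf [NeZero k] (m : ℕ) :
    decodableProb F k ε m ≤ waitCdf (1 - ε) k m := by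
  rw [← symbolLaw_real_received (F := F) (k := k),
    ← measureReal_le_successCount _ MeasurableSet.of_discrete]
  refine measureReal_mono fun y hy => ?_
  have hrank := finrank_receivedSpan_le F y
  rwa [show receivedSpan F y = ⊤ from hy, finrank_top, Module.finrank_fin_fun] at hrank

theorem waitCdf_le_decodableProb_add [NeZero k] (m : ℕ) :
    waitCdf (1 - ε) k m ≤ decodableProb F k ε m + m / Nat.card F := by
  let μ := Measure.pi fun _ : Fin m => symbolLaw F k ε
  have hc : ∀ V : Submodule F (Fin k → F), V ≠ ⊤ →
      symbolLaw F k ε {z | z.1 ∈ V} ≤ (Nat.card F : ENNReal)⁻¹ := fun V hV => by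
    have hprod : {z : (Fin k → F) × Bool | z.1 ∈ V} = (V : Set (Fin k → F)) ×ˢ Set.univ := by
      ext z
      simp
    rw [symbolLaw, hprod, Measure.prod_prod, measure_univ, mul_one]
    exact columnLaw_le hV
  have hdef : μ.real {y | Deficient F y} ≤ m / Nat.card F := by
    have hq : (Nat.card F : ENNReal)⁻¹ ≠ ⊤ :=
      ENNReal.inv_ne_top.2 (Nat.cast_ne_zero.2 Nat.card_pos.ne')
    simpa [div_eq_mul_inv, measureReal_def, μ] using
      ENNReal.toReal_mono (ENNReal.mul_ne_top (by simp) hq) (measure_deficient_le F hc m)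
  rw [← symbolLaw_real_received (F := F) (k := k),
    ← measureReal_le_successCount _ MeasurableSet.of_discrete]
  calc μ.real _ ≤ μ.real ({y | receivedSpan F y = ⊤} ∪ {y | Deficient F y}) :=
        measureReal_mono fun y hy => or_iff_not_imp_left.2
          (deficient_of_finrank_le F ((Module.finrank_fin_fun F).trans_le hy))
    _ ≤ μ.real {y | receivedSpan F y = ⊤} + μ.real {y | Deficient F y} := measureReal_union_le _ _
    _ ≤ _ := add_le_add_right hdef _

theorem decodableProb_pos (hε : (ε : ℝ) < 1) [NeZero k] {n : ℕ} (hn : k ≤ n) :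
    0 < decodableProb F k ε n := by
  let y : Fin n → (Fin k → F) × Bool := fun j => (Pi.single (Fin.ofNat k j) 1, false)
  have hy : receivedSpan F y = ⊤ := by
    rw [eq_top_iff, ← (Pi.basisFun F (Fin k)).span_eq]
    refine Submodule.span_mono ?_
    rintro _ ⟨i, rfl⟩
    refine ⟨i.castLE hn, rfl, ?_⟩
    simp [y]
  refine lt_of_lt_of_le ?_ (measureReal_mono (Set.singleton_subset_iff.2 hy))
  rw [measureReal_def, Measure.pi_singleton]
  refine ENNReal.toReal_pos (Finset.prod_ne_zero_iff.2 fun j _ => ?_)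
    (ENNReal.prod_ne_top fun _ _ => measure_ne_top _ _)
  rw [symbolLaw, ← Set.singleton_prod_singleton, Measure.prod_prod]
  refine mul_ne_zero ?_ ?_
  · rw [columnLaw, Ne, uniformOn_eq_zero_iff (Set.toFinite _)]
    exact Set.Nonempty.ne_empty ⟨_, by simp, rfl⟩
  · rw [← measureReal_ne_zero_iff, bernoulliMeasure_real_apply_of_notMem_of_mem _
      (measurableSet_singleton _) (by simp) rfl]
    exact (sub_pos.2 hε).ne'

end RandomColumns

theorem measurePreserving_zip_infinitePi {ι X Z : Type*} [MeasurableSpace X] [MeasurableSpace Z]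
    (μ : Measure X) (ν : Measure Z) [IsProbabilityMeasure μ] [IsProbabilityMeasure ν] :
    MeasurePreserving (fun (p : (ι → X) × (ι → Z)) i => (p.1 i, p.2 i))
      ((Measure.infinitePi fun _ => μ).prod (Measure.infinitePi fun _ => ν))
      (Measure.infinitePi fun _ => μ.prod ν) := by
  have hzip : Measurable fun (p : (ι → X) × (ι → Z)) i => (p.1 i, p.2 i) := by fun_prop
  refine ⟨hzip, ((Measure.isProjectiveLimit_infinitePi _).unique fun I => ?_).symm⟩
  have hrestrict : MeasurePreserving (Prod.map (I.restrict (π := fun _ => X))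
      (I.restrict (π := fun _ => Z)))
      ((Measure.infinitePi fun _ => μ).prod (Measure.infinitePi fun _ => ν))
      ((Measure.pi fun _ => μ).prod (Measure.pi fun _ => ν)) :=
    .prod ⟨by fun_prop, Measure.infinitePi_map_restrict _⟩
      ⟨by fun_prop, Measure.infinitePi_map_restrict _⟩
  rw [Measure.map_map (by fun_prop) hzip]
  exact ((measurePreserving_arrowProdEquivProdArrow X Z I _ _).symm.comp hrestrict).map_eq

section OnTheFly

variable {F : Type*} [Field F] {n k : ℕ}

theorem Scheme.channelOutput_eq_some_iff {S : Scheme F n k} {u : ℕ → Fin k → F} {e : ℕ → Bool}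
    {i : ℕ} {z : F} :
    S.channelOutput u e i = some z ↔ e i = false ∧ u (i / n * n) ⬝ᵥ S.col i = z := by
  cases h : e i <;> simp [Scheme.channelOutput, Scheme.channelInput, h]

theorem Scheme.channelOutput_ne_none_iff {S : Scheme F n k} {u : ℕ → Fin k → F} {e : ℕ → Bool}
    {i : ℕ} : S.channelOutput u e i ≠ none ↔ e i = false := by
  cases h : e i <;> simp [Scheme.channelOutput, h]

theorem eq_of_dotProduct_eq_of_span_eq_top {ι : Type*} [Fintype ι] {s : Set (ι → F)}
    (hs : Submodule.span F s = ⊤) {w w' : ι → F} (h : ∀ v ∈ s, w ⬝ᵥ v = w' ⬝ᵥ v) : w = w' :=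
  dotProduct_eq _ _ <| LinearMap.congr_fun <|
    LinearMap.ext_on (f := dotProductBilin F F w) (g := dotProductBilin F F w') hs h

theorem le_and_div_eq_div_iff (hn : 0 < n) {i m : ℕ} :
    (m ≤ i ∧ m / n = i / n) ↔ ∃ j : Fin (i % n + 1), m = i / n * n + j := by
  have hi := Nat.div_add_mod' i n
  constructor
  · rintro ⟨hle, hdiv⟩
    have hm := Nat.div_add_mod' m n
    rw [hdiv] at hm
    exact ⟨⟨m % n, by lia⟩, hm.symm⟩
  · rintro ⟨⟨j, hj⟩, rfl⟩
    have hjn : j < n := by have := Nat.mod_lt i hn; lia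
    exact ⟨by simp only; lia, by
      rw [mul_comm, Nat.mul_add_div hn, Nat.div_eq_of_lt hjn, add_zero]⟩

theorem span_unerased_columns (hn : 0 < n) (g u : ℕ → Fin k → F) (e : ℕ → Bool) (i : ℕ) :
    Submodule.span F {v | ∃ m : Fin (i + 1), (m : ℕ) / n = i / n ∧
        (onTheFly n g).channelOutput u e m ≠ none ∧ v = g m} =
      receivedSpan F fun j : Fin (i % n + 1) => (g (i / n * n + j), e (i / n * n + j)) := by
  rw [receivedSpan]
  congr 1
  ext v
  simp only [Scheme.channelOutput_ne_none_iff]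
  constructor
  · rintro ⟨m, hm, he, rfl⟩
    obtain ⟨j, hj⟩ := (le_and_div_eq_div_iff hn).1 ⟨Nat.le_of_lt_succ m.2, hm⟩
    exact ⟨j, by simpa [← hj] using he, by simp [← hj]⟩
  · rintro ⟨j, he, rfl⟩
    obtain ⟨hle, hdiv⟩ := (le_and_div_eq_div_iff hn (i := i)).2 ⟨j, rfl⟩
    exact ⟨⟨_, Nat.lt_succ_of_le hle⟩, hdiv, he, rfl⟩

open Classical in
theorem onTheFly_decoded (hn : 0 < n) (g u : ℕ → Fin k → F) (e : ℕ → Bool) (i : ℕ) :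
    (onTheFly n g).decoded u e i =
      if blockTest n (fun _ => {y | receivedSpan F y = ⊤}) (fun j => (g j, e j)) i
      then some (i / n * n, u (i / n * n)) else none := by
  have hspan := span_unerased_columns hn g u e i
  have htrue : ∀ m : Fin (i + 1), (m : ℕ) / n = i / n → ∀ z : F,
      (onTheFly n g).channelOutput u e m = some z → u (i / n * n) ⬝ᵥ g m = z :=
    fun m hm z hz => hm ▸ (Scheme.channelOutput_eq_some_iff.1 hz).2
  by_cases h : blockTest n (fun _ => {y | receivedSpan F y = ⊤}) (fun j => (g j, e j)) i
  · have htop := hspan.trans h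
    have hsolvable : ∃ w : Fin k → F, ∀ m : Fin (i + 1), (m : ℕ) / n = i / n → ∀ z : F,
        (onTheFly n g).channelOutput u e m = some z → w ⬝ᵥ g m = z := ⟨_, htrue⟩
    rw [if_pos h]
    refine (dif_pos ⟨htop, hsolvable⟩).trans ?_
    congr 2
    refine eq_of_dotProduct_eq_of_span_eq_top htop ?_
    rintro _ ⟨m, hm, hne, rfl⟩
    obtain ⟨z, hz⟩ := Option.ne_none_iff_exists'.1 hne
    rw [hsolvable.choose_spec m hm z hz, htrue m hm z hz]
  · rw [if_neg h]
    exact dif_neg fun hcond => h (hspan.symm.trans hcond.1)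

theorem onTheFly_zeroError (hn : 0 < n) (g : ℕ → Fin k → F) : (onTheFly n g).ZeroError := by
  classical
  intro u e i j w h
  rw [onTheFly_decoded hn, Option.ite_none_right_eq_some] at h
  cases h.2
  rfl

theorem onTheFly_freshest (hn : 0 < n) (g u : ℕ → Fin k → F) (e : ℕ → Bool) (N : ℕ) :
    (onTheFly n g).freshest u e N =
      freshestOf n (blockTest n (fun _ => {y | receivedSpan F y = ⊤}) fun j => (g j, e j)) N := by
  classical
  induction N with
  | zero => rfl
  | succ N ih =>
    rw [Scheme.freshest, freshestOf, onTheFly_decoded hn, ← ih]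
    split_ifs <;> rfl

end OnTheFly

section AverageAge

variable {F : Type*} [Field F] [Finite F] [MeasurableSpace F] {n k : ℕ} {ε : unitInterval}

instance isProbabilityMeasure_sourceLaw [DiscreteMeasurableSpace F] :
    IsProbabilityMeasure (sourceLaw F k) := by
  have : IsProbabilityMeasure (uniformOn (Set.univ : Set (Fin k → F))) :=
    isProbabilityMeasure_uniformOn Set.finite_univ Set.univ_nonempty
  unfold sourceLaw
  infer_instance

instance isProbabilityMeasure_erasureLaw : IsProbabilityMeasure (erasureLaw ε) := by
  unfold erasureLaw
  infer_instance

variable [DiscreteMeasurableSpace F]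

instance isProbabilityMeasure_randomCode [NeZero k] : IsProbabilityMeasure (randomCode F k) :=
  inferInstanceAs (IsProbabilityMeasure (Measure.infinitePi fun _ => columnLaw F k))

theorem HasAverageAge.averageAge_eq {S : Scheme F n k} {D : ℝ} (h : HasAverageAge ε S D) :
    averageAge ε S = D := by
  have hex : ∃ D, HasAverageAge ε S D := ⟨D, h⟩
  obtain ⟨p, hchoose, hD⟩ := (hex.choose_spec.and h).exists
  exact (dif_pos hex).trans (tendsto_nhds_unique hchoose hD)

theorem ae_hasAverageAge_onTheFly [NeZero k] (hε : (ε : ℝ) < 1) (hkn : k ≤ n) :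
    ∀ᵐ g ∂(randomCode F k),
      HasAverageAge ε (onTheFly n g) (ageOfCdf n (decodableProb F k ε)) := by
  have hn : 0 < n := (NeZero.pos k).trans_le hkn
  have hblocks := ae_tendsto_average_blockTest (ν := symbolLaw F k ε)
    (G := fun _ => {y | receivedSpan F y = ⊤}) hn (fun _ => MeasurableSet.of_discrete)
    (fun _ y hy => top_unique (hy.ge.trans (receivedSpan_init_le F y)))
    (decodableProb_pos hε hkn).ne'
  have hzip := measurePreserving_zip_infinitePi (ι := ℕ) (columnLaw F k)
    (bernoulliMeasure true false ε)
  filter_upwards [Measure.ae_ae_of_ae_prod (hzip.quasiMeasurePreserving.ae hblocks)] with g hg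
  filter_upwards [(Measure.quasiMeasurePreserving_snd (μ := sourceLaw F k)
    (ν := erasureLaw ε)).ae hg] with p hp
  simp only [Scheme.age, onTheFly_freshest hn]
  exact hp

theorem randomCodeAge_eq [NeZero k] (hε : (ε : ℝ) < 1) (hkn : k ≤ n) :
    randomCodeAge ε F n k = ageOfCdf n (decodableProb F k ε) := by
  have hconst : ∀ᵐ g ∂(randomCode F k),
      averageAge ε (onTheFly n g) = ageOfCdf n (decodableProb F k ε) :=
    (ae_hasAverageAge_onTheFly hε hkn).mono fun _ hg => hg.averageAge_eq
  rw [randomCodeAge, integral_congr_ae hconst]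
  simp

theorem ae_hasAverageAge_randomCodeAge [NeZero k] (hε : (ε : ℝ) < 1) (hkn : k ≤ n) :
    ∀ᵐ g ∂(randomCode F k), HasAverageAge ε (onTheFly n g) (randomCodeAge ε F n k) := by
  rw [randomCodeAge_eq hε hkn]
  exact ae_hasAverageAge_onTheFly hε hkn

theorem randomCodeAge_mem_achievedAges [NeZero k] (hε : (ε : ℝ) < 1) (hkn : k ≤ n) :
    randomCodeAge ε F n k ∈ achievedAges ε F k := by
  obtain ⟨g, hg⟩ := (ae_hasAverageAge_randomCodeAge (F := F) hε hkn).exists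
  exact ⟨n, hkn, onTheFly n g, onTheFly_zeroError ((NeZero.pos k).trans_le hkn) g, hg⟩

theorem ageLowerBound_le_randomCodeAge [NeZero k] (hε : (ε : ℝ) < 1) (hkn : k ≤ n) :
    ageLowerBound ε n k ≤ randomCodeAge ε F n k := by
  rw [ageLowerBound_eq_ageOfCdf hε NeZero.one_le hkn, randomCodeAge_eq hε hkn]
  refine ageOfCdf_le_ageOfCdf decodableProb_le_waitCdf (fun m => ?_) (decodableProb_pos hε hkn)
  exact measureReal_le_one

theorem exists_forall_randomCodeAge_lt [NeZero k] (hε : (ε : ℝ) < 1) (hkn : k ≤ n) {δ : ℝ}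
    (hδ : 0 < δ) : ∃ q₀ : ℕ, ∀ (F : Type*) [Field F] [Finite F] [MeasurableSpace F]
      [DiscreteMeasurableSpace F], q₀ ≤ Nat.card F →
        randomCodeAge ε F n k < ageLowerBound ε n k + δ := by
  have hp : (1 - ε : ℝ) ∈ Set.Ioc 0 1 := ⟨sub_pos.2 hε, sub_le_self _ ε.2.1⟩
  have hpos : 0 < waitCdf (1 - ε) k n := waitCdf_pos hp hkn
  let R (q m : ℕ) : ℝ := waitCdf (1 - ε) k m - m / q
  have hR : ∀ m, Tendsto (R · m) atTop (𝓝 (waitCdf (1 - ε) k m)) := fun m => by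
    simpa using (tendsto_const_div_atTop_nhds_zero_nat (m : ℝ)).const_sub (waitCdf (1 - ε) k m)
  have hage : ∀ᶠ q in atTop, ageOfCdf n (R q) < ageLowerBound ε n k + δ := by
    rw [ageLowerBound_eq_ageOfCdf hε NeZero.one_le hkn]
    exact (tendsto_ageOfCdf hR hpos.ne').eventually_lt_const (lt_add_of_pos_right _ hδ)
  obtain ⟨q₀, hq₀⟩ := eventually_atTop.1 (hage.and ((hR n).eventually_const_lt hpos))
  refine ⟨q₀, fun F _ _ _ _ hF => ?_⟩
  obtain ⟨hlt, hRn⟩ := hq₀ _ hF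
  rw [randomCodeAge_eq hε hkn]
  refine (ageOfCdf_le_ageOfCdf (fun m => ?_) (fun m => ?_) hRn).trans_lt hlt
  · exact sub_le_iff_le_add.2 (waitCdf_le_decodableProb_add m)
  · exact (sub_le_self _ (by positivity)).trans (waitCdf_mem_Icc ⟨hp.1.le, hp.2⟩ k m).2

end AverageAge

section Converse

variable {F : Type*} [Field F] {n k : ℕ} {S : Scheme F n k} {u : ℕ → Fin k → F} {e : ℕ → Bool}

theorem exists_ne_zero_forall_dotProduct_eq_zero {ι α : Type*} [Fintype ι] (c : α → ι → F)
    {s : Finset α} (hs : s.card < Fintype.card ι) : ∃ d ≠ 0, ∀ m ∈ s, d ⬝ᵥ c m = 0 := by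
  have hker := LinearMap.ker_ne_bot_of_finrank_lt (f := (Matrix.of fun m : s => c m).mulVecLin)
    (by simpa using hs)
  obtain ⟨d, hd, hd₀⟩ := Submodule.exists_mem_ne_zero_of_ne_bot hker
  exact ⟨d, hd₀, fun m hm => (dotProduct_comm _ _).trans (congrFun hd ⟨m, hm⟩)⟩

-- Otherwise a nonzero `d` orthogonal to the unerased columns of the block can be added to the
-- message without changing any channel output.
theorem Scheme.ZeroError.le_card_of_decoded (hS : S.ZeroError) {N j : ℕ} {w : Fin k → F}
    (h : S.decoded u e N = some (j, w)) :
    k ≤ ((Finset.range (N + 1)).filter fun m => m / n * n = j ∧ e m = false).card := by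
  by_contra! hlt
  obtain ⟨d, hd₀, hd⟩ := exists_ne_zero_forall_dotProduct_eq_zero S.col
    (hlt.trans_eq (Fintype.card_fin k).symm)
  let u' := Function.update u j (u j + d)
  have houtput : ∀ m : Fin (N + 1), S.channelOutput u' e m = S.channelOutput u e m := fun m => by
    cases he : e m with
    | true => simp [Scheme.channelOutput, he]
    | false =>
      simp only [Scheme.channelOutput, Scheme.channelInput, he, u']
      by_cases hj : (m : ℕ) / n * n = j
      · have hdm : d ⬝ᵥ S.col m = 0 :=
          hd m (Finset.mem_filter.2 ⟨Finset.mem_range.2 m.2, hj, he⟩)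
        simp [hj, add_dotProduct, hdm]
      · simp [Function.update_of_ne hj]
  have h' : S.decoded u' e N = some (j, w) := by
    rw [← h, Scheme.decoded, Scheme.decoded, funext houtput]
  have heq : u j + d = u j := by simpa [u'] using (hS u' e N j w h').symm.trans (hS u e N j w h)
  exact hd₀ (add_eq_left.1 heq)

theorem exists_blockTest_of_le_card (hn : 0 < n) (hk : 0 < k) {N j : ℕ}
    (h : k ≤ ((Finset.range (N + 1)).filter fun m => m / n * n = j ∧ e m = false).card) :
    ∃ i < N + 1, i / n * n = j ∧ blockTest n (fun _ => {y | k ≤ successCount {false} y}) e i := by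
  classical
  set s := (Finset.range (N + 1)).filter fun m => m / n * n = j ∧ e m = false with hs
  obtain ⟨i, hi, hmax⟩ := s.exists_max_image id (Finset.card_pos.1 (hk.trans_le h))
  simp only [hs, Finset.mem_filter, Finset.mem_range] at hi hmax
  refine ⟨i, hi.1, hi.2.1, h.trans ?_⟩
  refine Finset.card_le_card_of_surjOn (fun l : Fin (i % n + 1) => i / n * n + l) fun m hm => ?_
  simp only [hs, Finset.coe_filter, Finset.mem_range, Set.mem_ofPred_eq] at hm
  have hdiv : m / n = i / n := Nat.eq_of_mul_eq_mul_right hn (hm.2.1.trans hi.2.1.symm)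
  obtain ⟨l, hl⟩ := (le_and_div_eq_div_iff hn).1 ⟨hmax m hm, hdiv⟩
  exact ⟨l, by simpa using hl ▸ hm.2.2, hl.symm⟩

theorem Scheme.ZeroError.freshest_le (hS : S.ZeroError) (hn : 0 < n) (hk : 0 < k) (N : ℕ) :
    S.freshest u e N ≤
      freshestOf n (blockTest n (fun _ => {y | k ≤ successCount {false} y}) e) N := by
  induction N with
  | zero => exact le_rfl
  | succ N ih =>
    have hN := ih.trans (monotone_freshestOf _ _ N.le_succ)
    rw [Scheme.freshest]
    split
    · exact hN
    case h_2 j w h =>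
      obtain ⟨i, hi, rfl, hgood⟩ := exists_blockTest_of_le_card hn hk (hS.le_card_of_decoded h)
      exact max_le hN (le_freshestOf hgood hi)

theorem Scheme.monotone_freshest (S : Scheme F n k) (u : ℕ → Fin k → F) (e : ℕ → Bool) :
    Monotone (S.freshest u e) :=
  monotone_nat_of_le_succ fun N => by
    rw [Scheme.freshest]
    split
    · exact le_rfl
    · exact le_max_left _ _

variable [Finite F] [MeasurableSpace F] [DiscreteMeasurableSpace F] {ε : unitInterval}

theorem HasAverageAge.ageLowerBound_le {D : ℝ} (hD : HasAverageAge ε S D) (hS : S.ZeroError)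
    (hε : (ε : ℝ) < 1) (hk : 1 ≤ k) (hkn : k ≤ n) : ageLowerBound ε n k ≤ D := by
  have hn : 0 < n := hk.trans hkn
  have hp : (1 - ε : ℝ) ∈ Set.Ioc 0 1 := ⟨sub_pos.2 hε, sub_le_self _ ε.2.1⟩
  have hcdf : ∀ m, (Measure.pi fun _ : Fin m => bernoulliMeasure true false ε).real
      {y | k ≤ successCount {false} y} = waitCdf (1 - ε) k m := fun m => by
    rw [measureReal_le_successCount _ MeasurableSet.of_discrete]
    simp
  have hblocks := ae_tendsto_average_blockTest (ν := bernoulliMeasure true false ε)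
    (G := fun _ => {y | k ≤ successCount {false} y}) hn (fun _ => MeasurableSet.of_discrete)
    (fun _ y hy => le_trans hy (successCount_init_le _ y))
    (by simpa only [hcdf] using (waitCdf_pos hp hkn).ne')
  simp only [hcdf] at hblocks
  obtain ⟨p, hlower, hp⟩ := ((Measure.quasiMeasurePreserving_snd (μ := sourceLaw F k)
    (ν := erasureLaw ε)).ae hblocks |>.and hD).exists
  rw [ageLowerBound_eq_ageOfCdf hε hk hkn]
  refine le_of_tendsto_of_tendsto hlower hp ?_
  filter_upwards [eventually_gt_atTop 0] with τ hτ
  refine mul_le_mul_of_nonneg_left ?_ (by positivity)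
  refine intervalIntegral.integral_mono_on hτ.le
    (intervalIntegrable_id_sub_floor (Int.cast_mono.comp (monotone_freshestOf _ _)) _ _)
    (intervalIntegrable_id_sub_floor (Int.cast_mono.comp (S.monotone_freshest _ _)) _ _)
    fun t _ => ?_
  exact sub_le_sub_left (Int.cast_le.2 (hS.freshest_le hn hk _)) t

end Converse

section Optimum

variable {k : ℕ} {ε : unitInterval}

theorem tendsto_ageLowerBound (hε : (ε : ℝ) < 1) (hk : 1 ≤ k) :
    Tendsto (fun n => ageLowerBound ε n k) atTop atTop := by
  refine tendsto_atTop_mono' atTop ?_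
    (tendsto_natCast_atTop_atTop.atTop_div_const (zero_lt_two' ℝ))
  filter_upwards [eventually_ge_atTop k] with n hkn
  rw [ageLowerBound_eq_ageOfCdf hε hk hkn]
  have hcdf := waitCdf_mem_Icc ⟨sub_nonneg.2 hε.le, sub_le_self 1 ε.2.1⟩ k
  exact half_le_ageOfCdf (fun m => (hcdf m).2) (hcdf n).1

theorem exists_forall_ge_le_of_tendsto_atTop {f : ℕ → ℝ} (hf : Tendsto f atTop atTop) (k : ℕ) :
    ∃ n, k ≤ n ∧ ∀ m, k ≤ m → f n ≤ f m :=
  (Nat.cofinite_eq_atTop ▸ hf).exists_within_forall_le Set.nonempty_Ici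

variable {F : Type*} [Field F] [Finite F] [MeasurableSpace F] [DiscreteMeasurableSpace F]

theorem tendsto_randomCodeAge [NeZero k] (hε : (ε : ℝ) < 1) :
    Tendsto (fun n => randomCodeAge ε F n k) atTop atTop :=
  tendsto_atTop_mono' atTop
    ((eventually_ge_atTop k).mono fun _ => ageLowerBound_le_randomCodeAge hε)
    (tendsto_ageLowerBound hε NeZero.one_le)

theorem exists_isGLB_isLeast_abs_sub_lt [NeZero k] (hε : (ε : ℝ) < 1) {n₀ : ℕ} (hn₀ : k ≤ n₀)
    (hmin₀ : ∀ n, k ≤ n → ageLowerBound ε n₀ k ≤ ageLowerBound ε n k) {δ : ℝ}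
    (hlt : randomCodeAge ε F n₀ k < ageLowerBound ε n₀ k + δ) :
    ∃ Δopt Δmin : ℝ, IsGLB (achievedAges ε F k) Δopt ∧
      IsLeast {D : ℝ | ∃ n : ℕ, k ≤ n ∧ D = randomCodeAge ε F n k} Δmin ∧ |Δopt - Δmin| < δ := by
  have hlower : ageLowerBound ε n₀ k ∈ lowerBounds (achievedAges ε F k) := by
    rintro D ⟨n, hkn, S, hS, hD⟩
    exact (hmin₀ n hkn).trans (hD.ageLowerBound_le hS hε (NeZero.pos k) hkn)
  obtain ⟨n₁, hn₁, hmin₁⟩ := exists_forall_ge_le_of_tendsto_atTop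
    (tendsto_randomCodeAge (F := F) (k := k) hε) k
  have hmem := randomCodeAge_mem_achievedAges (F := F) hε hn₁
  have hglb := isGLB_csInf ⟨_, hmem⟩ ⟨_, hlower⟩
  refine ⟨_, _, hglb, ⟨⟨n₁, hn₁, rfl⟩, ?_⟩, ?_⟩
  · rintro _ ⟨n, hkn, rfl⟩
    exact hmin₁ n hkn
  · rw [abs_sub_lt_iff]
    constructor <;> linarith [hglb.1 hmem, hglb.2 hlower, hmin₁ n₀ hn₀]

end Optimum

end AgeErasure

end

theorem theorem6 (ε : unitInterval) (hε : (ε : ℝ) < 1) (k : ℕ) (hk : 1 ≤ k) :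
    -- The average age of the random code exists, and almost surely equals its expectation.
    (∀ (F : Type) [Field F] [Fintype F] [MeasurableSpace F] [DiscreteMeasurableSpace F] (n : ℕ),
      k ≤ n →
        ∀ᵐ g ∂(AgeErasure.randomCode F k),
          AgeErasure.HasAverageAge ε (AgeErasure.onTheFly n g)
            (AgeErasure.randomCodeAge ε F n k)) ∧
    -- For fixed `(n, k)` it is within `δ` of the lower bound for large alphabets.
    (∀ n : ℕ, k ≤ n → ∀ δ : ℝ, 0 < δ → ∃ q₀ : ℕ, 0 < q₀ ∧
      ∀ (F : Type) [Field F] [Fintype F] [MeasurableSpace F] [DiscreteMeasurableSpace F],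
        q₀ ≤ Fintype.card F →
          (∀ᵐ g ∂(AgeErasure.randomCode F k),
            |AgeErasure.averageAge ε (AgeErasure.onTheFly n g) -
              AgeErasure.ageLowerBound ε n k| < δ) ∧
          |AgeErasure.randomCodeAge ε F n k - AgeErasure.ageLowerBound ε n k| < δ) ∧
    -- The optimal average age and the minimum over `n ≥ k` of the random-code age differ by
    -- less than `δ` for large alphabets.
    (∀ δ : ℝ, 0 < δ → ∃ q₀ : ℕ, 0 < q₀ ∧
      ∀ (F : Type) [Field F] [Fintype F] [MeasurableSpace F] [DiscreteMeasurableSpace F],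
        q₀ ≤ Fintype.card F →
          ∃ Δopt Δmin : ℝ,
            IsGLB (AgeErasure.achievedAges ε F k) Δopt ∧
            IsLeast {D : ℝ | ∃ n : ℕ, k ≤ n ∧ D = AgeErasure.randomCodeAge ε F n k} Δmin ∧
            |Δopt - Δmin| < δ) := by
  have : NeZero k := ⟨Nat.one_le_iff_ne_zero.1 hk⟩
  refine ⟨fun F _ _ _ _ n hkn => AgeErasure.ae_hasAverageAge_randomCodeAge hε hkn,
    fun n hkn δ hδ => ?_, fun δ hδ => ?_⟩
  · obtain ⟨q₀, hq₀⟩ := AgeErasure.exists_forall_randomCodeAge_lt hε hkn hδ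
    refine ⟨q₀ + 1, q₀.succ_pos, fun F _ _ _ _ hF => ?_⟩
    have hclose : |AgeErasure.randomCodeAge ε F n k - AgeErasure.ageLowerBound ε n k| < δ := by
      rw [abs_of_nonneg (sub_nonneg.2 (AgeErasure.ageLowerBound_le_randomCodeAge hε hkn)),
        sub_lt_iff_lt_add']
      exact hq₀ F (Nat.card_eq_fintype_card (α := F) ▸ (Nat.le_succ q₀).trans hF)
    refine ⟨?_, hclose⟩
    filter_upwards [AgeErasure.ae_hasAverageAge_randomCodeAge (F := F) hε hkn] with g hg
    rwa [hg.averageAge_eq]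
  · obtain ⟨n₀, hn₀, hmin₀⟩ := AgeErasure.exists_forall_ge_le_of_tendsto_atTop
      (AgeErasure.tendsto_ageLowerBound hε hk) k
    obtain ⟨q₀, hq₀⟩ := AgeErasure.exists_forall_randomCodeAge_lt hε hn₀ hδ
    exact ⟨q₀ + 1, q₀.succ_pos, fun F _ _ _ _ hF =>
      AgeErasure.exists_isGLB_isLeast_abs_sub_lt hε hn₀ hmin₀
        (hq₀ F (Nat.card_eq_fintype_card (α := F) ▸ (Nat.le_succ q₀).trans hF))⟩
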